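/- A $2$-edge-coloured graph $\mathbb H$ is a finite vertex set $H$ with two symmetric binary relations $R(\mathbb H)$ (red edges) and $B(\mathbb H)$ (blue edges); loops are allowed, and a pair in both relations is a $\ast$-edge. It is \emph{reflexive complete} if $uv\in R(\mathbb H)\cup B(\mathbb H)$ for all $u,v\in H$ (including $u=v$). A homomorphism is a vertex map preserving red edges and blue edges. The \emph{core} of $\mathbb H$ is the induced subgraph of $\mathbb H$ (unique up to isomorphism) that is homomorphically equivalent to $\mathbb H$ and all of whose endomorphisms are bijective. The \emph{homogeneous concatenation} $\mathbb G\triangleleft_h\mathbb A$ is the disjoint union of $\mathbb G$ and $\mathbb A$ together with, for all $g\in G$ and $a\in A$, a blue edge $ga$ if $aa\in B(\mathbb A)$ and a red edge $ga$ if $aa\in R(\mathbb A)$. \textbf{Proposition.} There is an algorithm (a program for a random access machine with addition, subtraction, indirect addressing and unit costs) that, given a reflexive complete $2$-edge-coloured graph $\mathbb H$ by its red and blue adjacency matrices, decides in time polynomial in $|H|$ whether the core of $\mathbb H$ admits a decomposition (up to isomorphism) of the form \[\mathbb A_1\triangleleft_h\dots\triangleleft_h\mathbb A_k,\qquad k\ge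 1,\] where $\mathbb A_1$ is a structure on at most two elements, and for each $2\le i\le k$ the structure $\mathbb A_i$ is either a single vertex with a loop, or a reflexive $\ast$-edge (two vertices, each with a loop, joined by both a red and a blue edge). -/

import Mathlib

/-- A `2`-edge-coloured graph on the vertex set `V`: two symmetric binary relations.  Loops are
allowed, and a pair may carry both colours (a `∗`-edge). -/
structure ECGraph (V : Type) where
  red : V → V → Prop
  blue : V → V → Prop
  red_symm : ∀ u v, red u v → red v u
  blue_symm : ∀ u v, blue u v → blue v u

namespace ECGraph

variable {V W : Type}

/-- Every pair of vertices, equal or not, is joined by an edge of at least one colour. -/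
def IsReflexiveComplete (H : ECGraph V) : Prop :=
  ∀ u v, H.red u v ∨ H.blue u v

/-- Homomorphisms: maps of the vertices that preserve red edges and blue edges. -/
def IsHom (G : ECGraph V) (H : ECGraph W) (f : V → W) : Prop :=
  (∀ u v, G.red u v → H.red (f u) (f v)) ∧ (∀ u v, G.blue u v → H.blue (f u) (f v))

/-- `G → H` and `H → G`. -/
def HomEquivalent (G : ECGraph V) (H : ECGraph W) : Prop :=
  (∃ f, IsHom G H f) ∧ (∃ g, IsHom H G g)

/-- Isomorphism of `2`-edge-coloured graphs. -/
def Isomorphic (G : ECGraph V) (H : ECGraph W) : Prop :=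
  ∃ e : V ≃ W, (∀ u v, G.red u v ↔ H.red (e u) (e v)) ∧
    (∀ u v, G.blue u v ↔ H.blue (e u) (e v))

/-- The subgraph induced by a set of vertices. -/
def induce (H : ECGraph V) (S : Set V) : ECGraph S where
  red u v := H.red u v
  blue u v := H.blue u v
  red_symm _ _ h := H.red_symm _ _ h
  blue_symm _ _ h := H.blue_symm _ _ h

/-- Every endomorphism is an automorphism, that is, bijective. -/
def IsCore (H : ECGraph V) : Prop :=
  ∀ f, IsHom H H f → Function.Bijective f

/-- Homogeneous concatenation `H ◁ₕ A`: the disjoint union of `H` and `A`, together with all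
edges between `h` in `H` and `a` in `A` that have a colour of the loop at `a`. -/
def hconcat (H : ECGraph V) (A : ECGraph W) : ECGraph (V ⊕ W) where
  red
    | .inl u, .inl v => H.red u v
    | .inl _, .inr a => A.red a a
    | .inr a, .inl _ => A.red a a
    | .inr a, .inr b => A.red a b
  blue
    | .inl u, .inl v => H.blue u v
    | .inl _, .inr a => A.blue a a
    | .inr a, .inl _ => A.blue a a
    | .inr a, .inr b => A.blue a b
  red_symm := by
    rintro (u | u) (v | v) h
    exacts [H.red_symm _ _ h, h, h, A.red_symm _ _ h]
  blue_symm := by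
    rintro (u | u) (v | v) h
    exacts [H.blue_symm _ _ h, h, h, A.blue_symm _ _ h]

/-- There is a loop, of some colour, at each vertex. -/
def IsReflexive (A : ECGraph V) : Prop :=
  ∀ v, A.red v v ∨ A.blue v v

/-- A single vertex with a loop. -/
def IsLoopedVertex (A : ECGraph V) : Prop :=
  Nat.card V = 1 ∧ A.IsReflexive

/-- Two vertices with loops, joined by an edge of both colours. -/
def IsReflexiveStarEdge (A : ECGraph V) : Prop :=
  Nat.card V = 2 ∧ A.IsReflexive ∧ ∀ u v, u ≠ v → A.red u v ∧ A.blue u v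

/-- `G` is literally of the form `(…(A₁ ◁ₕ A₂) ◁ₕ …) ◁ₕ Aₖ` with `k ≥ 1`, where `A₁` has at most
two elements, and each later `Aᵢ` is a single looped vertex or a reflexive `∗`-edge. -/
inductive IsConcatenation : ∀ {V : Type}, ECGraph V → Prop
  | base {V : Type} (A : ECGraph V) (hfin : Finite V) (hcard : Nat.card V ≤ 2) :
      IsConcatenation A
  | concat {V W : Type} (G : ECGraph V) (A : ECGraph W) (hG : IsConcatenation G)
      (hA : A.IsLoopedVertex ∨ A.IsReflexiveStarEdge) : IsConcatenation (G.hconcat A)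

/-- The decomposition `A₁ ◁ₕ … ◁ₕ Aₖ` exists up to isomorphism. -/
def AdmitsDecomposition (H : ECGraph V) : Prop :=
  ∃ (W : Type) (G : ECGraph W), G.IsConcatenation ∧ G.Isomorphic H

/-- The core of `H` (the induced subgraph, unique up to isomorphism, that is a core and is
homomorphically equivalent to `H`) admits the decomposition. -/
def CoreAdmitsDecomposition (H : ECGraph V) : Prop :=
  ∃ S : Set V, (H.induce S).IsCore ∧ (H.induce S).HomEquivalent H ∧
    (H.induce S).AdmitsDecomposition

end ECGraph

namespace RAM

/-- Memory of a random access machine: registers `reg 0, reg 1, …`, and arrays `arr 0, arr 1, …`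
with entries indexed by `ℕ`.  A program names only finitely many registers and arrays. -/
structure State where
  reg : ℕ → ℕ
  arr : ℕ → ℕ → ℕ

/-- Write a value into register `x`. -/
def State.setReg (s : State) (x v : ℕ) : State :=
  { s with reg := Function.update s.reg x v }

/-- Write a value into entry `i` of array `a`. -/
def State.setArr (s : State) (a i v : ℕ) : State :=
  { s with arr := Function.update s.arr a (Function.update (s.arr a) i v) }

/-- Structured programs of a random access machine with addition, truncated subtraction and
indirect addressing.  (No multiplication: in `t` steps a number grows by at most `t` bits, so
that the uniform cost measure is polynomially equivalent to time on Turing machines.) -/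
inductive Program
  | skip
  | const (x c : ℕ)
  | add (x y z : ℕ)
  | sub (x y z : ℕ)
  | load (x a y : ℕ)
  | store (a y x : ℕ)
  | seq (P Q : Program)
  | ifNonzero (x : ℕ) (P Q : Program)
  | whileNonzero (x : ℕ) (P : Program)

/-- `Exec P s s' t`: started in memory `s`, the program `P` halts with memory `s'` after exactly
`t` steps.  Each elementary instruction and each test of a register is one step. -/
inductive Exec : Program → State → State → ℕ → Prop
  | skip (s : State) : Exec .skip s s 1
  | const (x c : ℕ) (s : State) : Exec (.const x c) s (s.setReg x c) 1
  | add (x y z : ℕ) (s : State) :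
      Exec (.add x y z) s (s.setReg x (s.reg y + s.reg z)) 1
  | sub (x y z : ℕ) (s : State) :
      Exec (.sub x y z) s (s.setReg x (s.reg y - s.reg z)) 1
  | load (x a y : ℕ) (s : State) :
      Exec (.load x a y) s (s.setReg x (s.arr a (s.reg y))) 1
  | store (a y x : ℕ) (s : State) :
      Exec (.store a y x) s (s.setArr a (s.reg y) (s.reg x)) 1
  | seq {P Q : Program} {s₁ s₂ s₃ : State} {t₁ t₂ : ℕ} (hP : Exec P s₁ s₂ t₁)
      (hQ : Exec Q s₂ s₃ t₂) : Exec (.seq P Q) s₁ s₃ (t₁ + t₂)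
  | ifTrue {x : ℕ} {P Q : Program} {s s' : State} {t : ℕ} (hx : s.reg x ≠ 0)
      (hP : Exec P s s' t) : Exec (.ifNonzero x P Q) s s' (t + 1)
  | ifFalse {x : ℕ} {P Q : Program} {s s' : State} {t : ℕ} (hx : s.reg x = 0)
      (hQ : Exec Q s s' t) : Exec (.ifNonzero x P Q) s s' (t + 1)
  | whileDone {x : ℕ} {P : Program} {s : State} (hx : s.reg x = 0) :
      Exec (.whileNonzero x P) s s 1
  | whileStep {x : ℕ} {P : Program} {s₁ s₂ s₃ : State} {t₁ t₂ : ℕ} (hx : s₁.reg x ≠ 0)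
      (hP : Exec P s₁ s₂ t₁) (hW : Exec (.whileNonzero x P) s₂ s₃ t₂) :
      Exec (.whileNonzero x P) s₁ s₃ (t₁ + t₂ + 1)

open Classical in
/-- The initial memory on input `H`: register `0` holds the number `n` of vertices, arrays `0` and
`1` hold the adjacency matrices of the red and of the blue edges, row by row, and the rest of the
memory is zero. -/
noncomputable def input {n : ℕ} (H : ECGraph (Fin n)) : State where
  reg x := if x = 0 then n else 0
  arr a k :=
    if ∃ i j : Fin n, k = i * n + j ∧ ((a = 0 ∧ H.red i j) ∨ (a = 1 ∧ H.blue i j)) then 1 else 0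

end RAM

/-! Decomposability passes to induced subgraphs, so the core need not be computed: it is
decomposable iff `H` maps homomorphically to some decomposable induced subgraph (`Dec`,
`coreAdmitsDecomposition_iff`).

Whether vertices `e false`, `e true` can form the last part on a set `U` of remaining vertices is a
2-SAT question. Suppose `x` goes to `e i`, there is an edge `xy` of colour `c`, and `e i` has no
`c`-edge to `e (!j)`. Then `y` must go to `e j`: a `c`-edge from `e i` to an earlier part would, by
homogeneity, give a `c`-loop at `e i`, while distinct vertices of the last part are joined in both
colours. The `peelSet` consists of the vertices with a literal that does not imply its own negation.
Since implications can be contraposed, such literals can be chosen for all these vertices at once,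
forcing nothing on the other vertices (`exists_assignment`).

Three facts make greedy peeling correct. Homomorphisms preserve the complement of the peel set, so
deleting the peel set preserves `Dec` (`Dec.diff_peelSet`). Conversely, if the peel set contains
both `e i`, it can be put back by mapping it to a new last part (`Dec.of_diff_peelSet`); this uses
reflexive completeness. Finally, if a nonempty `U` satisfies `Dec`, the last part of a minimal image
is such a pair (`Dec.exists_mem_peelSet`). Hence no choice of pair is ever wrong, and the answer is
yes iff peeling ends with no vertex.

At most `n` rounds over all pairs suffice, and closing a literal under implication takes at most
`2n` passes over all pairs of vertices. The procedure is written in a small language whose only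
loops run `n` times; such commands compile to machine programs with a polynomial time bound
(`Command.exec_compile`). -/

/-! ### Commands with bounded loops and their compilation in polynomial time. -/

namespace RAM

/-- A memory whose array entries are all `0` or `1`, as the set of pairs `(array, index)` at which
the entry is `1`. -/
abbrev Store := Set (ℕ × ℕ)

open Classical in
/-- The arrays described by a store. -/
noncomputable def Store.arr (σ : Store) (a i : ℕ) : ℕ := if (a, i) ∈ σ then 1 else 0

/-- Quantifier-free conditions on registers and arrays. -/
inductive Cond
  | mem (a x : ℕ)
  | mat (a x y : ℕ)
  | not (φ : Cond)
  | and (φ ψ : Cond)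

namespace Cond

def Holds : Cond → (ℕ → ℕ) → Store → Prop
  | mem a x, ρ, σ => (a, ρ x) ∈ σ
  | mat a x y, ρ, σ => (a, ρ x * ρ 0 + ρ y) ∈ σ
  | not φ, ρ, σ => ¬ φ.Holds ρ σ
  | and φ ψ, ρ, σ => φ.Holds ρ σ ∧ ψ.Holds ρ σ

/-- All registers mentioned are below `k`. -/
def Scoped (k : ℕ) : Cond → Prop
  | mem _ x => x < k
  | mat _ x y => x < k ∧ y < k
  | not φ => φ.Scoped k
  | and φ ψ => φ.Scoped k ∧ ψ.Scoped k

/-- A program that leaves the truth value in register `k`, and uses registers from `k` on. -/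
def compile (k : ℕ) : Cond → Program
  | mem a x => .load k a x
  | mat a x y =>
    .seq (.const k 0) (.seq (.const (k + 2) 1) (.seq (.add (k + 1) x k) (.seq
      (.whileNonzero (k + 1) (.seq (.add k k 0) (.sub (k + 1) (k + 1) (k + 2))))
      (.seq (.add k k y) (.load k a k)))))
  | not φ => .seq (φ.compile k) (.seq (.const (k + 1) 1) (.sub k (k + 1) k))
  | and φ ψ => .seq (φ.compile k) (.ifNonzero k (ψ.compile k) .skip)

noncomputable def cost : Cond → Polynomial ℕ
  | mem _ _ => 1
  | mat _ _ _ => 3 * Polynomial.X + 6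
  | not φ => φ.cost + 2
  | and φ ψ => φ.cost + ψ.cost + 2

theorem Holds.congr {k : ℕ} (hk : 0 < k) {φ : Cond} (hφ : φ.Scoped k) {ρ ρ' : ℕ → ℕ}
    (h : ∀ r < k, ρ r = ρ' r) (σ : Store) : φ.Holds ρ σ ↔ φ.Holds ρ' σ := by
  induction φ with
  | mem a x => simp only [Holds, h x hφ]
  | mat a x y => simp only [Holds, h x hφ.1, h y hφ.2, h 0 hk]
  | not φ ih => simp only [Holds, ih hφ]
  | and φ ψ ih₁ ih₂ => simp only [Holds, ih₁ hφ.1, ih₂ hφ.2]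

end Cond

/-- Row-major indices need a product, which the machine obtains by repeated addition. An iteration
costs two instructions and a test; the last test accounts for the `+ 1`. -/
theorem exec_multiply (k : ℕ) (hk : 0 < k) (m : ℕ) (s : State) (hm : s.reg (k + 1) = m)
    (h1 : s.reg (k + 2) = 1) :
    ∃ s', Exec (.whileNonzero (k + 1) (.seq (.add k k 0) (.sub (k + 1) (k + 1) (k + 2)))) s s'
      (3 * m + 1) ∧ s'.arr = s.arr ∧ (∀ r < k, s'.reg r = s.reg r) ∧
      s'.reg k = s.reg k + m * s.reg 0 := by
  induction m generalizing s with
  | zero => exact ⟨s, .whileDone hm, rfl, fun _ _ => rfl, by simp⟩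
  | succ m ih =>
    let s₁ := s.setReg k (s.reg k + s.reg 0)
    let s₂ := s₁.setReg (k + 1) (s₁.reg (k + 1) - s₁.reg (k + 2))
    obtain ⟨s', hex, harr, hlt, hval⟩ := ih s₂ (by simp [s₂, s₁, State.setReg, hm, h1])
      (by simp [s₂, s₁, State.setReg, h1])
    refine ⟨s', ?_, harr, fun r hr => ?_, ?_⟩
    · have := Exec.whileStep (x := k + 1) (s₁ := s) (by omega)
        (.seq (.add k k 0 s) (.sub (k + 1) (k + 1) (k + 2) s₁)) hex
      convert this using 1
      omega
    · rw [hlt r hr]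
      simp [s₂, s₁, State.setReg, Function.update_of_ne (by omega : r ≠ k + 1),
        Function.update_of_ne (by omega : r ≠ k)]
    · rw [hval]
      simp [s₂, s₁, State.setReg, Function.update_of_ne (by omega : 0 ≠ k)]
      ring

open Classical in
theorem Cond.exec_compile {k : ℕ} (hk : 0 < k) (φ : Cond) (hφ : φ.Scoped k) (s : State)
    (σ : Store) (hs : s.arr = σ.arr) (hb : ∀ r < k, s.reg r ≤ s.reg 0) :
    ∃ s' t, Exec (φ.compile k) s s' t ∧ t ≤ φ.cost.eval (s.reg 0) ∧ s'.arr = s.arr ∧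
      (∀ r < k, s'.reg r = s.reg r) ∧ s'.reg k = if φ.Holds s.reg σ then 1 else 0 := by
  induction φ generalizing s with
  | mem a x =>
    refine ⟨_, _, .load k a x s, by simp [cost], rfl, fun r hr => ?_, ?_⟩
    · simp [State.setReg, Function.update_of_ne hr.ne]
    · by_cases h : (a, s.reg x) ∈ σ <;> simp [State.setReg, hs, Store.arr, Holds, h]
  | mat a x y =>
    obtain ⟨hx, hy⟩ := hφ
    let s₁ := s.setReg k 0
    let s₂ := s₁.setReg (k + 2) 1
    let s₃ := s₂.setReg (k + 1) (s₂.reg x + s₂.reg k)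
    obtain ⟨s₄, hex, harr, hlt, hval⟩ := exec_multiply k hk (s.reg x) s₃
      (by simp [s₃, s₂, s₁, State.setReg, Function.update_of_ne (by omega : x ≠ k),
        Function.update_of_ne (by omega : x ≠ k + 2)])
      (by simp [s₃, s₂, s₁, State.setReg])
    have key : ∀ r < k, s₃.reg r = s.reg r := fun r hr => by
      simp [s₃, s₂, s₁, State.setReg, Function.update_of_ne (by omega : r ≠ k),
        Function.update_of_ne (by omega : r ≠ k + 2), Function.update_of_ne (by omega : r ≠ k + 1)]
    let s₅ := s₄.setReg k (s₄.reg k + s₄.reg y)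
    refine ⟨_, _, .seq (.const k 0 s) (.seq (.const (k + 2) 1 s₁) (.seq (.add (k + 1) x k s₂)
      (.seq hex (.seq (.add k k y s₄) (.load k a k s₅))))), ?_, harr, fun r hr => ?_, ?_⟩
    · have := hb x hx
      simp [cost]
      omega
    · simp [s₅, State.setReg, Function.update_of_ne hr.ne, hlt r hr, key r hr]
    · have h0 : s₃.reg k = 0 := by simp [s₃, s₂, s₁, State.setReg]
      have h5 : s₅.reg k = s.reg x * s.reg 0 + s.reg y := by
        simp [s₅, State.setReg, hval, hlt y hy, key y hy, key 0 hk, h0]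
      have ha : s₅.arr = σ.arr := harr.trans hs
      by_cases h : (a, s.reg x * s.reg 0 + s.reg y) ∈ σ <;>
        simp [State.setReg, h5, ha, Store.arr, Holds, h]
  | not φ ih =>
    obtain ⟨s₁, t, hex, ht, harr, hlt, hval⟩ := ih hφ s hs hb
    refine ⟨_, _, .seq hex (.seq (.const (k + 1) 1 s₁) (.sub k (k + 1) k _)), ?_, harr,
      fun r hr => ?_, ?_⟩
    · simp [cost]
      omega
    · simp [State.setReg, Function.update_of_ne hr.ne, Function.update_of_ne
        (by omega : r ≠ k + 1), hlt r hr]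
    · by_cases h : φ.Holds s.reg σ <;> simp [State.setReg, hval, Holds, h]
  | and φ ψ ih₁ ih₂ =>
    obtain ⟨s₁, t₁, hex₁, ht₁, harr₁, hlt₁, hval₁⟩ := ih₁ hφ.1 s hs hb
    by_cases h : φ.Holds s.reg σ
    · obtain ⟨s₂, t₂, hex₂, ht₂, harr₂, hlt₂, hval₂⟩ := ih₂ hφ.2 s₁ (harr₁.trans hs)
        (fun r hr => by rw [hlt₁ r hr, hlt₁ 0 hk]; exact hb r hr)
      refine ⟨s₂, _, .seq hex₁ (.ifTrue (by simp [hval₁, h]) hex₂), ?_, harr₂.trans harr₁,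
        fun r hr => (hlt₂ r hr).trans (hlt₁ r hr), ?_⟩
      · rw [hlt₁ 0 hk] at ht₂
        simp [cost]
        omega
      · simp [hval₂, Holds, h, Holds.congr hk hφ.2 hlt₁]
    · refine ⟨s₁, _, .seq hex₁ (.ifFalse (by simp [hval₁, h]) (.skip s₁)), ?_, harr₁, hlt₁, ?_⟩
      · simp [cost]
        omega
      · simp [hval₁, Holds, h]

theorem Store.arr_insert (σ : Store) (s : State) (hs : s.arr = σ.arr) (a i : ℕ) :
    (s.setArr a i 1).arr = Store.arr (insert (a, i) σ) := by
  funext b j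
  by_cases hb : b = a
  · subst hb
    by_cases hj : j = i
    · subst hj; simp [State.setArr, Store.arr]
    · by_cases h : (b, j) ∈ σ <;> simp [State.setArr, Store.arr, hs, hj, h]
  · by_cases h : (b, j) ∈ σ <;> simp [State.setArr, Store.arr, hs, hb, h]

theorem Store.arr_diff (σ : Store) (s : State) (hs : s.arr = σ.arr) (a i : ℕ) :
    (s.setArr a i 0).arr = Store.arr (σ \ {(a, i)}) := by
  funext b j
  by_cases hb : b = a
  · subst hb
    by_cases hj : j = i
    · subst hj; simp [State.setArr, Store.arr]
    · by_cases h : (b, j) ∈ σ <;> simp [State.setArr, Store.arr, hs, hj, h]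
  · by_cases h : (b, j) ∈ σ <;> simp [State.setArr, Store.arr, hs, hb, h]

/-- Apply `G 0`, `G 1`, …, `G (n - 1)` in this order. -/
def runLoop {α : Type} (G : ℕ → α → α) : ℕ → α → α
  | 0, a => a
  | n + 1, a => G n (runLoop G n a)

/-- Commands with loops that run as often as the number in register `0` says. A command at level
`k` may use the registers below `k` as constants; the counter of a loop at level `k` is register
`k`, and its body is at level `k + 1`. -/
inductive Command
  | put (a x : ℕ)
  | del (a x : ℕ)
  | seq (c d : Command)
  | ite (φ : Cond) (c : Command)
  | loop (c : Command)

namespace Command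

def run (k : ℕ) : Command → (ℕ → ℕ) → Store → Store
  | put a x, ρ, σ => insert (a, ρ x) σ
  | del a x, ρ, σ => σ \ {(a, ρ x)}
  | seq c d, ρ, σ => d.run k ρ (c.run k ρ σ)
  | ite φ c, ρ, σ => open Classical in if φ.Holds ρ σ then c.run k ρ σ else σ
  | loop c, ρ, σ => runLoop (fun v => c.run (k + 1) (Function.update ρ k v)) (ρ 0) σ

def Scoped (k : ℕ) : Command → Prop
  | put _ x => x < k
  | del _ x => x < k
  | seq c d => c.Scoped k ∧ d.Scoped k
  | ite φ c => φ.Scoped k ∧ c.Scoped k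
  | loop c => c.Scoped (k + 1)

/-- In a loop, register `k + 1` holds `n` minus the counter and controls the `while`. The body may
overwrite it, so it is recomputed after each iteration. -/
def compile (k : ℕ) : Command → Program
  | put a x => .seq (.const k 1) (.store a x k)
  | del a x => .seq (.const k 0) (.store a x k)
  | seq c d => .seq (c.compile k) (d.compile k)
  | ite φ c => .seq (φ.compile k) (.ifNonzero k (c.compile k) .skip)
  | loop c => .seq (.const k 0) (.seq (.sub (k + 1) 0 k) (.whileNonzero (k + 1)
      (.seq (c.compile (k + 1)) (.seq (.const (k + 1) 1) (.seq (.add k k (k + 1))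
        (.sub (k + 1) 0 k))))))

noncomputable def cost : Command → Polynomial ℕ
  | put _ _ => 2
  | del _ _ => 2
  | seq c d => c.cost + d.cost
  | ite φ c => φ.cost + c.cost + 2
  | loop c => Polynomial.X * (c.cost + 4) + 3

theorem run_congr {k : ℕ} (hk : 0 < k) {c : Command} (hc : c.Scoped k) {ρ ρ' : ℕ → ℕ}
    (h : ∀ r < k, ρ r = ρ' r) (σ : Store) : c.run k ρ σ = c.run k ρ' σ := by
  induction c generalizing k ρ ρ' σ with
  | put a x => simp only [run, h x hc]
  | del a x => simp only [run, h x hc]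
  | seq c d ih₁ ih₂ => simp only [run, ih₁ hk hc.1 h, ih₂ hk hc.2 h]
  | ite φ c ih =>
    by_cases hφ : φ.Holds ρ σ
    · simp only [run, if_pos hφ, if_pos ((Cond.Holds.congr hk hc.1 h σ).1 hφ), ih hk hc.2 h]
    · simp only [run, if_neg hφ, if_neg (mt (Cond.Holds.congr hk hc.1 h σ).2 hφ)]
  | loop c ih =>
    simp only [run, h 0 hk]
    congr 1
    funext v τ
    refine ih (by omega) hc (fun r hr => ?_) τ
    by_cases hrk : r = k
    · simp [hrk]
    · simp [Function.update_of_ne hrk, h r (by omega)]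

/-- The bound `hb` is needed because a matrix lookup takes time proportional to the contents of a
register. Loop counters stay below `n` while the body runs, so the bound is inherited by the body.
-/
theorem exec_compile {k : ℕ} (hk : 0 < k) (c : Command) (hc : c.Scoped k) (s : State)
    (σ : Store) (hs : s.arr = σ.arr) (hb : ∀ r < k, s.reg r ≤ s.reg 0) :
    ∃ s' t, Exec (c.compile k) s s' t ∧ t ≤ c.cost.eval (s.reg 0) ∧
      (∀ r < k, s'.reg r = s.reg r) ∧ s'.arr = (c.run k s.reg σ).arr := by
  induction c generalizing k s σ with
  | put a x =>
    refine ⟨_, _, .seq (.const k 1 s) (.store a x k _), by simp [cost], fun r hr => ?_, ?_⟩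
    · simp [State.setReg, State.setArr, Function.update_of_ne hr.ne]
    · have hx : x ≠ k := Nat.ne_of_lt hc
      have := Store.arr_insert σ (s.setReg k 1) hs a (s.reg x)
      simpa [State.setReg, Function.update_of_ne hx, run] using this
  | del a x =>
    refine ⟨_, _, .seq (.const k 0 s) (.store a x k _), by simp [cost], fun r hr => ?_, ?_⟩
    · simp [State.setReg, State.setArr, Function.update_of_ne hr.ne]
    · have hx : x ≠ k := Nat.ne_of_lt hc
      have := Store.arr_diff σ (s.setReg k 0) hs a (s.reg x)
      simpa [State.setReg, Function.update_of_ne hx, run] using this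
  | seq c d ih₁ ih₂ =>
    obtain ⟨s₁, t₁, hex₁, ht₁, hlt₁, harr₁⟩ := ih₁ hk hc.1 s σ hs hb
    obtain ⟨s₂, t₂, hex₂, ht₂, hlt₂, harr₂⟩ := ih₂ hk hc.2 s₁ _ harr₁
      (fun r hr => by rw [hlt₁ r hr, hlt₁ 0 hk]; exact hb r hr)
    refine ⟨s₂, _, .seq hex₁ hex₂, ?_, fun r hr => (hlt₂ r hr).trans (hlt₁ r hr), ?_⟩
    · rw [hlt₁ 0 hk] at ht₂
      simp [cost]
      omega
    · rw [harr₂, run, run_congr hk hc.2 hlt₁]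
  | ite φ c ih =>
    obtain ⟨s₁, t₁, hex₁, ht₁, harr₁, hlt₁, hval₁⟩ := φ.exec_compile hk hc.1 s σ hs hb
    by_cases h : φ.Holds s.reg σ
    · obtain ⟨s₂, t₂, hex₂, ht₂, hlt₂, harr₂⟩ := ih hk hc.2 s₁ σ (harr₁.trans hs)
        (fun r hr => by rw [hlt₁ r hr, hlt₁ 0 hk]; exact hb r hr)
      refine ⟨s₂, _, .seq hex₁ (.ifTrue (by simp [hval₁, h]) hex₂), ?_,
        fun r hr => (hlt₂ r hr).trans (hlt₁ r hr), ?_⟩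
      · rw [hlt₁ 0 hk] at ht₂
        simp [cost]
        omega
      · rw [harr₂, run, if_pos h, run_congr hk hc.2 hlt₁]
    · refine ⟨s₁, _, .seq hex₁ (.ifFalse (by simp [hval₁, h]) (.skip s₁)), ?_, hlt₁, ?_⟩
      · simp [cost]
        omega
      · rw [harr₁, hs, run, if_neg h]
  | loop c ih =>
    -- Induction on the number `m` of iterations still to run, so that the counter is `n - m`.
    have main : ∀ (m : ℕ) (s' : State), m ≤ s.reg 0 → (∀ r < k, s'.reg r = s.reg r) →
        s'.reg k = s.reg 0 - m → s'.reg (k + 1) = m →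
        s'.arr = Store.arr (runLoop (fun v => c.run (k + 1) (Function.update s.reg k v))
          (s.reg 0 - m) σ) →
        ∃ s'' t, Exec (.whileNonzero (k + 1) (.seq (c.compile (k + 1)) (.seq (.const (k + 1) 1)
            (.seq (.add k k (k + 1)) (.sub (k + 1) 0 k))))) s' s'' t ∧
          t ≤ m * (c.cost.eval (s.reg 0) + 4) + 1 ∧ (∀ r < k, s''.reg r = s.reg r) ∧
          s''.arr = Store.arr (runLoop (fun v => c.run (k + 1) (Function.update s.reg k v))
            (s.reg 0) σ) := by
      intro m
      induction m with
      | zero =>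
        intro s' _ hlt _ hz harr
        exact ⟨s', 1, .whileDone hz, by simp, hlt, harr⟩
      | succ m ihm =>
        intro s' hm hlt hk' hz harr
        obtain ⟨s₁, t₁, hex₁, ht₁, hlt₁, harr₁⟩ := ih (k := k + 1) (by omega) hc s' _ harr
          (fun r hr => by
            rw [hlt 0 hk]
            by_cases hrk : r = k
            · subst hrk; omega
            · rw [hlt r (by omega)]; exact hb r (by omega))
        let s₂ := s₁.setReg (k + 1) 1
        let s₃ := s₂.setReg k (s₂.reg k + s₂.reg (k + 1))
        let s₄ := s₃.setReg (k + 1) (s₃.reg 0 - s₃.reg k)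
        have hlt₄ : ∀ r < k, s₄.reg r = s.reg r := fun r hr => by
          simp [s₄, s₃, s₂, State.setReg, Function.update_of_ne (by omega : r ≠ k),
            Function.update_of_ne (by omega : r ≠ k + 1), hlt₁ r (by omega), hlt r hr]
        have h0 : s₁.reg 0 = s.reg 0 := (hlt₁ 0 (by omega)).trans (hlt 0 hk)
        have hk₁ : s₁.reg k = s.reg 0 - (m + 1) := (hlt₁ k (by omega)).trans hk'
        have hk₄ : s₄.reg k = s.reg 0 - m := by
          simp [s₄, s₃, s₂, State.setReg, hk₁]
          omega
        obtain ⟨s₅, t₅, hex₅, ht₅, hlt₅, harr₅⟩ := ihm s₄ (by omega) hlt₄ hk₄ (by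
          simp [s₄, s₃, s₂, State.setReg, hk₁, h0, Function.update_of_ne (by omega : 0 ≠ k)]
          omega) (by
          change s₁.arr = _
          rw [harr₁]
          have : s.reg 0 - m = (s.reg 0 - (m + 1)) + 1 := by omega
          rw [this, runLoop]
          congr 1
          refine run_congr (c := c) (by omega) hc (fun r hr => ?_) _
          by_cases hrk : r = k
          · subst hrk; simp [hk']
          · simp [Function.update_of_ne hrk, hlt r (by omega)])
        refine ⟨s₅, _, .whileStep (by omega) (.seq hex₁ (.seq (.const (k + 1) 1 s₁)
          (.seq (.add k k (k + 1) s₂) (.sub (k + 1) 0 k s₃)))) hex₅, ?_, hlt₅, harr₅⟩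
        rw [hlt 0 hk] at ht₁
        rw [Nat.succ_mul]
        omega
    let s₁ := s.setReg k 0
    let s₂ := s₁.setReg (k + 1) (s₁.reg 0 - s₁.reg k)
    have h0k : 0 ≠ k := by omega
    obtain ⟨s₃, t, hex, ht, hlt, harr⟩ := main (s.reg 0) s₂ le_rfl (fun r hr => by
        simp [s₂, s₁, State.setReg, Function.update_of_ne (by omega : r ≠ k),
          Function.update_of_ne (by omega : r ≠ k + 1)])
      (by simp [s₂, s₁, State.setReg]) (by simp [s₂, s₁, State.setReg, Function.update_of_ne h0k])
      (by rw [Nat.sub_self]; exact hs)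
    refine ⟨s₃, _, .seq (.const k 0 s) (.seq (.sub (k + 1) 0 k s₁) hex), ?_, hlt, harr⟩
    simp [cost]
    omega

end Command

end RAM

/-! ### Decompositions and induced subgraphs. -/

namespace ECGraph

open Relation

variable {V W : Type}

/-- The edges of one colour: `true` stands for red and `false` for blue. -/
def edge (G : ECGraph V) : Bool → V → V → Prop
  | true => G.red
  | false => G.blue

theorem edge_comm (G : ECGraph V) {c : Bool} {u v : V} : G.edge c u v ↔ G.edge c v u := by
  cases c
  exacts [⟨G.blue_symm _ _, G.blue_symm _ _⟩, ⟨G.red_symm _ _, G.red_symm _ _⟩]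

theorem IsReflexiveComplete.exists_edge {G : ECGraph V} (hG : G.IsReflexiveComplete) (u v : V) :
    ∃ c, G.edge c u v :=
  (hG u v).elim (fun h => ⟨true, h⟩) (fun h => ⟨false, h⟩)

theorem isHom_iff {G : ECGraph V} {H : ECGraph W} {f : V → W} :
    IsHom G H f ↔ ∀ c u v, G.edge c u v → H.edge c (f u) (f v) := by
  rw [Bool.forall_bool]
  exact and_comm

theorem isomorphic_iff {G : ECGraph V} {H : ECGraph W} :
    G.Isomorphic H ↔ ∃ e : V ≃ W, ∀ c u v, G.edge c u v ↔ H.edge c (e u) (e v) := by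
  simp only [Bool.forall_bool]
  exact exists_congr fun e => and_comm

theorem edge_induce (G : ECGraph V) (S : Set V) (c : Bool) (u v : S) :
    (G.induce S).edge c u v ↔ G.edge c u v := by
  cases c <;> rfl

theorem edge_hconcat_inl_inl (G : ECGraph V) (A : ECGraph W) (c : Bool) (u v : V) :
    (G.hconcat A).edge c (.inl u) (.inl v) ↔ G.edge c u v := by
  cases c <;> rfl

theorem edge_hconcat_inl_inr (G : ECGraph V) (A : ECGraph W) (c : Bool) (u : V) (a : W) :
    (G.hconcat A).edge c (.inl u) (.inr a) ↔ A.edge c a a := by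
  cases c <;> rfl

theorem edge_hconcat_inr_inl (G : ECGraph V) (A : ECGraph W) (c : Bool) (u : V) (a : W) :
    (G.hconcat A).edge c (.inr a) (.inl u) ↔ A.edge c a a := by
  cases c <;> rfl

theorem edge_hconcat_inr_inr (G : ECGraph V) (A : ECGraph W) (c : Bool) (a b : W) :
    (G.hconcat A).edge c (.inr a) (.inr b) ↔ A.edge c a b := by
  cases c <;> rfl

theorem isReflexive_iff {A : ECGraph V} : A.IsReflexive ↔ ∀ v, ∃ c, A.edge c v v := by
  refine forall_congr' fun v => ?_
  rw [Bool.exists_bool]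
  exact or_comm

theorem admitsDecomposition_of_split (H : ECGraph V) (T : Set V)
    (hT : (H.induce T).AdmitsDecomposition)
    (hA : (H.induce Tᶜ).IsLoopedVertex ∨ (H.induce Tᶜ).IsReflexiveStarEdge)
    (h : ∀ c, ∀ u ∈ T, ∀ a ∉ T, H.edge c u a ↔ H.edge c a a) : H.AdmitsDecomposition := by
  classical
  obtain ⟨W, G, hG, hiso⟩ := hT
  obtain ⟨e, he⟩ := isomorphic_iff.1 hiso
  refine ⟨_, _, .concat G (H.induce Tᶜ) hG hA, isomorphic_iff.2
    ⟨(Equiv.sumCongr e (Equiv.refl _)).trans (Equiv.Set.sumCompl T), ?_⟩⟩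
  rintro c (u | a) (v | b)
  · rw [edge_hconcat_inl_inl, he, edge_induce]
    simp
  · rw [edge_hconcat_inl_inr, edge_induce]
    simpa using (h c (e u) (e u).2 b b.2).symm
  · rw [edge_hconcat_inr_inl, edge_induce]
    simpa [H.edge_comm (u := (a : V)) (v := e v)] using (h c (e v) (e v).2 a a.2).symm
  · rw [edge_hconcat_inr_inr, edge_induce]
    simp

/-- An induced subgraph meets every part in a subset. A nonempty subset of a later part is again a
looped vertex or a reflexive star-edge, and an empty one is dropped. -/
theorem IsConcatenation.admitsDecomposition_of_embedding {G : ECGraph W} (hG : G.IsConcatenation) :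
    ∀ {V : Type} (H : ECGraph V) (f : V → W), Function.Injective f →
      (∀ c u v, H.edge c u v ↔ G.edge c (f u) (f v)) → H.AdmitsDecomposition := by
  induction hG with
  | base A hfin hcard =>
    intro V H f hf _
    exact ⟨V, H, .base H (Finite.of_injective f hf)
      ((Nat.card_le_card_of_injective f hf).trans hcard), isomorphic_iff.2
      ⟨Equiv.refl V, fun _ _ _ => Iff.rfl⟩⟩
  | @concat X Y G A hG hA ih =>
    intro V H f hf hfe
    let T : Set V := {u | ∃ g, f u = .inl g}
    have hT : ∀ u : T, ∃ g, f u = .inl g := fun u => u.2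
    choose p hp using hT
    have hTc : ∀ u : (Tᶜ : Set V), ∃ a, f u = .inr a := by
      rintro ⟨u, hu⟩
      rcases hfu : f u with g | a
      · exact absurd ⟨g, hfu⟩ hu
      · exact ⟨a, rfl⟩
    choose q hq using hTc
    have hdec : (H.induce T).AdmitsDecomposition := by
      refine ih _ p (fun u v huv => Subtype.ext (hf (by rw [hp, hp, huv]))) fun c u v => ?_
      rw [edge_induce, hfe, hp, hp, edge_hconcat_inl_inl]
    have hqinj : Function.Injective q := fun u v huv => Subtype.ext (hf (by rw [hq, hq, huv]))
    have hqe : ∀ c (u v : (Tᶜ : Set V)), (H.induce Tᶜ).edge c u v ↔ A.edge c (q u) (q v) := by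
      intro c u v
      rw [edge_induce, hfe, hq, hq, edge_hconcat_inr_inr]
    by_cases hne : (Tᶜ : Set V).Nonempty
    · have hrefl : (H.induce Tᶜ).IsReflexive := by
        rw [isReflexive_iff]
        intro v
        obtain ⟨c, hc⟩ := (isReflexive_iff.1 (hA.elim (·.2) (·.2.1))) (q v)
        exact ⟨c, (hqe c v v).2 hc⟩
      have hfin : Finite Y := Nat.finite_of_card_ne_zero (by
        rcases hA with h | h <;> rw [h.1] <;> decide)
      have hfin' : Finite (Tᶜ : Set V) := Finite.of_injective q hqinj
      have hpos : 0 < Nat.card (Tᶜ : Set V) := by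
        have := hne.to_subtype
        exact Nat.card_pos
      have hle := Nat.card_le_card_of_injective q hqinj
      refine admitsDecomposition_of_split H T hdec ?_ fun c u hu a ha => ?_
      · rcases hA with hA | hA
        · rw [hA.1] at hle
          exact .inl ⟨by omega, hrefl⟩
        · rw [hA.1] at hle
          by_cases h1 : Nat.card (Tᶜ : Set V) = 1
          · exact .inl ⟨h1, hrefl⟩
          · refine .inr ⟨by omega, hrefl, fun u v huv => ?_⟩
            have := hA.2.2 (q u) (q v) (hqinj.ne huv)
            exact ⟨(hqe true u v).2 this.1, (hqe false u v).2 this.2⟩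
      · rw [hfe, hfe, hp ⟨u, hu⟩, hq ⟨a, ha⟩, edge_hconcat_inl_inr, edge_hconcat_inr_inr]
    · have hall : ∀ u, u ∈ T := fun u => by_contra fun hu => hne ⟨u, hu⟩
      refine ih H (fun u => p ⟨u, hall u⟩) (fun u v huv => hf ?_) fun c u v => ?_
      · rw [hp ⟨u, hall u⟩, hp ⟨v, hall v⟩]
        exact congrArg _ huv
      · rw [hfe, hp ⟨u, hall u⟩, hp ⟨v, hall v⟩, edge_hconcat_inl_inl]

theorem AdmitsDecomposition.of_embedding {G : ECGraph W} (hG : G.AdmitsDecomposition)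
    (H : ECGraph V) (f : V → W) (hf : Function.Injective f)
    (hfe : ∀ c u v, H.edge c u v ↔ G.edge c (f u) (f v)) : H.AdmitsDecomposition := by
  obtain ⟨X, K, hK, hiso⟩ := hG
  obtain ⟨e, he⟩ := isomorphic_iff.1 hiso
  refine hK.admitsDecomposition_of_embedding H (e.symm ∘ f) (e.symm.injective.comp hf) fun c u v => ?_
  rw [hfe, he]
  simp

theorem AdmitsDecomposition.mono {G : ECGraph V} {S T : Set V}
    (h : (G.induce T).AdmitsDecomposition) (hST : S ⊆ T) : (G.induce S).AdmitsDecomposition :=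
  h.of_embedding _ (Set.inclusion hST) (Set.inclusion_injective hST) fun c u v => by
    rw [edge_induce, edge_induce]

theorem admitsDecomposition_of_card_le_two [Finite V] (G : ECGraph V) (h : Nat.card V ≤ 2) :
    G.AdmitsDecomposition :=
  ⟨V, G, .base G inferInstance h, isomorphic_iff.2 ⟨Equiv.refl V, fun _ _ _ => Iff.rfl⟩⟩

/-! ### Homomorphisms to decomposable subgraphs. -/

/-- `f` restricts to a homomorphism from the subgraph induced by `U` to that induced by `S`. -/
def HomOn (G : ECGraph V) (f : V → V) (U S : Set V) : Prop :=
  Set.MapsTo f U S ∧ ∀ c, ∀ u ∈ U, ∀ v ∈ U, G.edge c u v → G.edge c (f u) (f v)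

theorem HomOn.comp {G : ECGraph V} {f g : V → V} {U S T : Set V} (hg : G.HomOn g S T)
    (hf : G.HomOn f U S) : G.HomOn (g ∘ f) U T :=
  ⟨hg.1.comp hf.1, fun c u hu v hv h => hg.2 c _ (hf.1 hu) _ (hf.1 hv) (hf.2 c u hu v hv h)⟩

/-- The subgraph induced by `U` maps to a decomposable subgraph of itself. -/
def Dec (G : ECGraph V) (U : Set V) : Prop :=
  ∃ S ⊆ U, (∃ f, G.HomOn f U S) ∧ (G.induce S).AdmitsDecomposition

/-- For an inclusion-minimal witness `S`, the image of `S` under an endomorphism is again a witness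
by heredity, hence all of `S`. -/
theorem Dec.exists_minimal [Finite V] {G : ECGraph V} {U : Set V} (h : G.Dec U) :
    ∃ S ⊆ U, (∃ f, G.HomOn f U S) ∧ (G.induce S).AdmitsDecomposition ∧
      ∀ g, G.HomOn g S S → Set.BijOn g S S := by
  obtain ⟨S, ⟨hSU, hf, hS⟩, hmin⟩ := (Set.toFinite {S : Set V | S ⊆ U ∧ (∃ f, G.HomOn f U S) ∧
    (G.induce S).AdmitsDecomposition}).exists_minimal h
  refine ⟨S, hSU, hf, hS, fun g hg => ?_⟩
  obtain ⟨f, hf⟩ := hf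
  have hsub : g '' S ⊆ S := hg.1.image_subset
  have : S ⊆ g '' S := hmin ⟨hsub.trans hSU,
    ⟨g ∘ f, HomOn.comp (S := S) ⟨Set.mapsTo_image g S, hg.2⟩ hf⟩, hS.mono hsub⟩ hsub
  have hsurj : Set.SurjOn g S S := this
  exact (S.toFinite.surjOn_iff_bijOn_of_mapsTo hg.1).1 hsurj

theorem coreAdmitsDecomposition_iff [Finite V] (G : ECGraph V) :
    G.CoreAdmitsDecomposition ↔ G.Dec Set.univ := by
  constructor
  · rintro ⟨S, -, ⟨-, g, hg⟩, hS⟩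
    refine ⟨S, Set.subset_univ S, ⟨fun v => g v, fun v _ => (g v).2, fun c u _ v _ h => ?_⟩, hS⟩
    exact (edge_induce G S c _ _).1 (isHom_iff.1 hg c u v h)
  · intro h
    obtain ⟨S, -, ⟨f, hf⟩, hS, hbij⟩ := h.exists_minimal
    refine ⟨S, fun g hg => ?_, ⟨⟨Subtype.val, isHom_iff.2 fun c u v h => (edge_induce G S c u v).1 h⟩,
      fun v => ⟨f v, hf.1 (Set.mem_univ v)⟩, isHom_iff.2 fun c u v h => ?_⟩, hS⟩
    · classical
      let g' : V → V := fun v => if hv : v ∈ S then g ⟨v, hv⟩ else v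
      have hg' : ∀ v : S, g' v = g v := fun v => by simp [g']
      have := hbij g' ⟨fun v hv => by rw [hg' ⟨v, hv⟩]; exact (g _).2, fun c u hu v hv h => by
        rw [hg' ⟨u, hu⟩, hg' ⟨v, hv⟩, ← edge_induce G S]
        exact isHom_iff.1 hg c _ _ ((edge_induce G S c ⟨u, hu⟩ ⟨v, hv⟩).2 h)⟩
      refine Finite.injective_iff_bijective.1 fun u v huv => Subtype.ext ?_
      exact this.injOn u.2 v.2 (by rw [hg', hg', huv])
    · rw [edge_induce]
      exact hf.2 c u (Set.mem_univ u) v (Set.mem_univ v) h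

theorem dec_empty (G : ECGraph V) : G.Dec ∅ :=
  ⟨∅, le_rfl, ⟨id, fun _ h => h, fun _ _ _ _ _ h => h⟩, admitsDecomposition_of_card_le_two _ (by simp)⟩

/-! ### The 2-SAT structure of maps to a pair of vertices. -/

/-- Implications between the literals `x ↦ e i` for maps from `U` to `{e false, e true}`: if `x`
is mapped to `e i`, then `y` cannot be mapped to `e (!j)`. -/
def Step (G : ECGraph V) (U : Set V) (e : Bool → V) (p q : V × Bool) : Prop :=
  p.1 ∈ U ∧ q.1 ∈ U ∧ ∃ c, G.edge c p.1 q.1 ∧ ¬ G.edge c (e p.2) (e !q.2)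

/-- The vertices with a consistent literal. -/
def peelSet (G : ECGraph V) (U : Set V) (e : Bool → V) : Set V :=
  {x ∈ U | ∃ i, ¬ ReflTransGen (G.Step U e) (x, i) (x, !i)}

theorem Step.contrapose {G : ECGraph V} {U : Set V} {e : Bool → V} {x y : V} {i j : Bool}
    (h : G.Step U e (x, i) (y, j)) : G.Step U e (y, !j) (x, !i) := by
  obtain ⟨hx, hy, c, h₁, h₂⟩ := h
  refine ⟨hy, hx, c, G.edge_comm.1 h₁, fun h => h₂ ?_⟩
  simpa using G.edge_comm.1 h

theorem reflTransGen_step_contrapose {G : ECGraph V} {U : Set V} {e : Bool → V} {p q : V × Bool}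
    (h : ReflTransGen (G.Step U e) p q) :
    ReflTransGen (G.Step U e) (q.1, !q.2) (p.1, !p.2) := by
  induction h with
  | refl => exact .refl
  | tail _ hstep ih => exact .head (Step.contrapose hstep) ih

/-- A set of literals that is closed under implications and has no contradictory pair. -/
def IsConsistent (G : ECGraph V) (U : Set V) (e : Bool → V) (F : Set (V × Bool)) : Prop :=
  (∀ p ∈ F, p.1 ∈ U) ∧ (∀ p ∈ F, ∀ q, G.Step U e p q → q ∈ F) ∧
    ∀ x i, (x, i) ∈ F → (x, !i) ∉ F

theorem IsConsistent.mem_of_reflTransGen {G : ECGraph V} {U : Set V} {e : Bool → V}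
    {F : Set (V × Bool)} (hF : G.IsConsistent U e F) {p q : V × Bool} (hp : p ∈ F)
    (h : ReflTransGen (G.Step U e) p q) : q ∈ F := by
  induction h with
  | refl => exact hp
  | tail _ hstep ih => exact hF.2.1 _ ih _ hstep

/-- If a literal implied by `(x, i)` contradicted `F`, contraposition would put `(x, !i)` into `F`.
If `(x, i)` implied both literals of some `y`, contraposing one of the implications would lead from
`(x, i)` to `(x, !i)`. -/
theorem isConsistent_closure {G : ECGraph V} {U : Set V} {e : Bool → V}
    {F : Set (V × Bool)} (hF : G.IsConsistent U e F) {x : V} {i : Bool} (hxU : x ∈ U)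
    (hx : ∀ j, (x, j) ∉ F) (hi : ¬ ReflTransGen (G.Step U e) (x, i) (x, !i)) :
    G.IsConsistent U e (F ∪ {q | ReflTransGen (G.Step U e) (x, i) q}) := by
  have hcross : ∀ y j, (y, j) ∈ F → ¬ ReflTransGen (G.Step U e) (x, i) (y, !j) := by
    intro y j hy hr
    have := reflTransGen_step_contrapose hr
    simp only [Bool.not_not] at this
    exact hx _ (hF.mem_of_reflTransGen hy this)
  refine ⟨?_, ?_, ?_⟩
  · rintro p (hp | hp)
    · exact hF.1 p hp
    · rcases ReflTransGen.cases_tail hp with h | ⟨_, -, h⟩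
      · rw [h]; exact hxU
      · exact h.2.1
  · rintro p (hp | hp) q hq
    · exact .inl (hF.2.1 p hp q hq)
    · exact .inr (ReflTransGen.tail hp hq)
  · rintro y j (hy | hy) (hy' | hy')
    · exact hF.2.2 y j hy hy'
    · exact hcross y j hy hy'
    · exact hcross y (!j) hy' (by simpa using hy)
    · have := reflTransGen_step_contrapose hy'
      simp only [Bool.not_not] at this
      exact hi (ReflTransGen.trans hy this)

/-- The consistent literals can be chosen simultaneously. -/
theorem exists_assignment (G : ECGraph V) (U : Set V) (e : Bool → V) :
    ∃ h : V → Bool, ∀ x ∈ G.peelSet U e, ∀ y j, G.Step U e (x, h x) (y, j) →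
      y ∈ G.peelSet U e ∧ h y = j := by
  classical
  -- A maximal consistent set has a literal for every vertex of the peel set, by
  -- `isConsistent_closure`, and for no other vertex.
  obtain ⟨F, hF⟩ := zorn_subset {F | G.IsConsistent U e F} (by
    intro C hC hchain
    refine ⟨⋃₀ C, ⟨?_, ?_, ?_⟩, fun F hF => Set.subset_sUnion_of_mem hF⟩
    · rintro p ⟨F, hF, hp⟩
      exact (hC hF).1 p hp
    · rintro p ⟨F, hF, hp⟩ q hq
      exact ⟨F, hF, (hC hF).2.1 p hp q hq⟩
    · rintro x i ⟨F, hF, hp⟩ ⟨F', hF', hp'⟩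
      rcases hchain.total hF hF' with hsub | hsub
      · exact (hC hF').2.2 x i (hsub hp) hp'
      · exact (hC hF).2.2 x i hp (hsub hp'))
  have hcons : G.IsConsistent U e F := hF.prop
  have hdom : ∀ x ∈ G.peelSet U e, ∃ i, (x, i) ∈ F := by
    rintro x ⟨hxU, i, hi⟩
    by_contra! hx
    have := hF.le_of_ge (isConsistent_closure hcons hxU hx hi) Set.subset_union_left
    exact hx i (this (.inr .refl))
  have hmem : ∀ y j, (y, j) ∈ F → y ∈ G.peelSet U e := fun y j hy =>
    ⟨hcons.1 _ hy, j, fun hr => hcons.2.2 y j hy (hcons.mem_of_reflTransGen hy hr)⟩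
  have hval : ∀ y j, (y, j) ∈ F → decide ((y, true) ∈ F) = j := by
    rintro y (_ | _) hy
    · exact decide_eq_false (hcons.2.2 y false hy)
    · exact decide_eq_true hy
  refine ⟨fun y => decide ((y, true) ∈ F), fun x hx y j hstep => ?_⟩
  obtain ⟨i, hi⟩ := hdom x hx
  simp only [hval x i hi] at hstep
  have := hcons.2.1 _ hi _ hstep
  exact ⟨hmem y j this, hval y j this⟩

/-- A homomorphism into `U` carries implications between literals to implications with the same
signs, so a contradiction at `x` becomes one at `f x`. -/
theorem mem_peelSet_of_hom {G : ECGraph V} {U S : Set V} {e : Bool → V} {f : V → V}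
    (hf : G.HomOn f U S) (hSU : S ⊆ U) {x : V} (hx : x ∈ U) (h : f x ∈ G.peelSet U e) :
    x ∈ G.peelSet U e := by
  obtain ⟨_, i, hi⟩ := h
  refine ⟨hx, i, fun hr => hi ?_⟩
  refine hr.lift (fun p : V × Bool => (f p.1, p.2)) ?_
  rintro p q ⟨hp, hq, c, h₁, h₂⟩
  exact ⟨hSU (hf.1 hp), hSU (hf.1 hq), c, hf.2 c _ hp _ hq h₁, h₂⟩

/-! ### Removing a peel set and putting it back. -/

theorem Dec.diff_peelSet {G : ECGraph V} {U : Set V} (h : G.Dec U) (e : Bool → V) :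
    G.Dec (U \ G.peelSet U e) := by
  obtain ⟨S, hSU, ⟨f, hf⟩, hS⟩ := h
  refine ⟨S \ G.peelSet U e, Set.sdiff_subset_sdiff_left hSU, ⟨f, fun x hx => ⟨hf.1 hx.1, fun h =>
    hx.2 (mem_peelSet_of_hom hf hSU hx.1 h)⟩, fun c u hu v hv => hf.2 c u hu.1 v hv.1⟩,
    hS.mono Set.sdiff_subset⟩

/-- Gluing `r` on `M` to a map of the rest makes `A` the new last part. An edge between `M` and the
rest survives because its colour occurs as a loop at the image in `A`, and `A` is homogeneous
towards the rest. -/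
theorem Dec.of_diff {G : ECGraph V} {U M A : Set V} (h : G.Dec (U \ M)) (hMU : M ⊆ U)
    (hAM : A ⊆ M) (r : V → V) (hr : Set.MapsTo r M A)
    (hMM : ∀ c, ∀ x ∈ M, ∀ y ∈ M, G.edge c x y → G.edge c (r x) (r y))
    (hMU' : ∀ c, ∀ x ∈ M, ∀ y ∈ U \ M, G.edge c x y → G.edge c (r x) (r x))
    (hA : ∀ c, ∀ a ∈ A, ∀ y ∈ U \ M, G.edge c a y ↔ G.edge c a a)
    (hA' : (G.induce A).IsLoopedVertex ∨ (G.induce A).IsReflexiveStarEdge) : G.Dec U := by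
  classical
  obtain ⟨S, hS, ⟨f, hf⟩, hdec⟩ := h
  refine ⟨S ∪ A, Set.union_subset (hS.trans Set.sdiff_subset) (hAM.trans hMU),
    ⟨fun x => if x ∈ M then r x else f x, fun x hx => ?_, fun c x hx y hy hxy => ?_⟩, ?_⟩
  · by_cases hxM : x ∈ M
    · simp only [if_pos hxM]; exact .inr (hr hxM)
    · simp only [if_neg hxM]; exact .inl (hf.1 ⟨hx, hxM⟩)
  · by_cases hxM : x ∈ M <;> by_cases hyM : y ∈ M
    · simp only [if_pos hxM, if_pos hyM]
      exact hMM c x hxM y hyM hxy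
    · simp only [if_pos hxM, if_neg hyM]
      exact (hA c _ (hr hxM) _ (hS (hf.1 ⟨hy, hyM⟩))).2 (hMU' c x hxM y ⟨hy, hyM⟩ hxy)
    · simp only [if_neg hxM, if_pos hyM]
      exact G.edge_comm.1 ((hA c _ (hr hyM) _ (hS (hf.1 ⟨hx, hxM⟩))).2
        (hMU' c y hyM x ⟨hx, hxM⟩ (G.edge_comm.1 hxy)))
    · simp only [if_neg hxM, if_neg hyM]
      exact hf.2 c x ⟨hx, hxM⟩ y ⟨hy, hyM⟩ hxy
  · let T : Set ↥(S ∪ A) := {u | u.1 ∈ S}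
    have hTc : ∀ u : ↥(S ∪ A), u ∉ T → u.1 ∈ A := fun u hu => u.2.resolve_left hu
    have hAS : ∀ a ∈ A, a ∉ S := fun a ha haS => (hS haS).2 (hAM ha)
    refine admitsDecomposition_of_split _ T (hdec.of_embedding _ (fun u => ⟨u.1.1, u.2⟩)
      (fun u v huv => Subtype.ext (Subtype.ext (by simpa using huv))) fun c u v => ?_) ?_
      fun c u hu a ha => ?_
    · simp only [edge_induce]
    · let q : (Tᶜ : Set ↥(S ∪ A)) ≃ A :=
        { toFun := fun u => ⟨u.1.1, hTc u.1 u.2⟩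
          invFun := fun a => ⟨⟨a.1, .inr a.2⟩, hAS a.1 a.2⟩
          left_inv := fun _ => rfl
          right_inv := fun _ => rfl }
      rw [IsLoopedVertex, IsReflexiveStarEdge, Nat.card_congr q]
      refine hA'.imp (fun h => ⟨h.1, fun v => h.2 (q v)⟩) (fun h => ⟨h.1, fun v => h.2.1 (q v),
        fun u v huv => h.2.2 (q u) (q v) (q.injective.ne huv)⟩)
    · rw [edge_induce, edge_induce, G.edge_comm]
      exact hA c _ (hTc a ha) _ (hS hu)

theorem Dec.of_diff_peelSet {G : ECGraph V} (hG : G.IsReflexiveComplete) {U : Set V}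
    {e : Bool → V} (he : ∀ i, e i ∈ G.peelSet U e) (h : G.Dec (U \ G.peelSet U e)) :
    G.Dec U := by
  set M := G.peelSet U e with hM
  have hMU : M ⊆ U := fun x hx => hx.1
  obtain ⟨σ, hσ⟩ := G.exists_assignment U e
  rw [← hM] at hσ
  have hMM : ∀ c, ∀ x ∈ M, ∀ y ∈ M, G.edge c x y → G.edge c (e (σ x)) (e (σ y)) := by
    intro c x hx y hy hxy
    by_contra hc
    have := (hσ x hx y (!σ y) ⟨hMU hx, hMU hy, c, hxy, by simpa using hc⟩).2
    simp at this
  -- Otherwise the chosen literal of `x` would imply a literal of `y`, and `y` would lie in `M`.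
  have hMU' : ∀ c, ∀ x ∈ M, ∀ y ∈ U \ M, G.edge c x y → ∀ j, G.edge c (e (σ x)) (e j) := by
    intro c x hx y hy hxy j
    by_contra hc
    exact hy.2 (hσ x hx y (!j) ⟨hMU hx, hy.1, c, hxy, by simpa using hc⟩).1
  rcases (U \ M).eq_empty_or_nonempty with hempty | ⟨y₀, hy₀⟩
  · have hUM : U ⊆ M := Set.sdiff_eq_empty.1 hempty
    refine ⟨Set.range e, fun x ⟨i, hi⟩ => hi ▸ hMU (he i), ⟨fun x => e (σ x), fun x _ => ⟨_, rfl⟩,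
      fun c u hu v hv => hMM c u (hUM hu) v (hUM hv)⟩, admitsDecomposition_of_card_le_two _ ?_⟩
    have := Finite.card_range_le e
    simpa using this
  -- If `x` had loops of both colours, so would `e (σ x)`. Then no implication leads from sign `σ x`
  -- to the opposite sign, and the literal `(y₀, σ x)` would be consistent although `y₀` is not in
  -- `M`.
  have hloop : ∀ x ∈ M, ∀ c c', G.edge c x x → G.edge c' x x → c = c' := by
    intro x hx c c' hc hc'
    by_contra hne
    have hall : ∀ d, G.edge d (e (σ x)) (e (σ x)) := by
      intro d
      rcases Bool.eq_or_eq_not d c with rfl | h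
      · exact hMM _ x hx x hx hc
      · have : d = c' := by rw [h]; revert hne; cases c <;> cases c' <;> simp
        rw [this]; exact hMM _ x hx x hx hc'
    refine hy₀.2 ⟨hy₀.1, σ x, fun hr => ?_⟩
    have key : ∀ q, ReflTransGen (G.Step U e) (y₀, σ x) q → q.2 = σ x := by
      intro q hq
      induction hq with
      | refl => rfl
      | @tail p q _ hstep ih =>
        obtain ⟨-, -, c, -, h₂⟩ := hstep
        by_contra hne
        rw [ih, show (!q.2) = σ x by revert hne; cases q.2 <;> cases σ x <;> simp] at h₂
        exact h₂ (hall c)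
    simpa using key _ hr
  choose k hk using fun i => hG.exists_edge (e i) (e i)
  have hkσ : ∀ i, k i = k (σ (e i)) := fun i =>
    hloop (e (σ (e i))) (he _) _ _ (hMM _ _ (he i) _ (he i) (hk i)) (hk _)
  -- Such an edge forces a loop of its colour at `e (σ (e i))`, whose only loop colour is that of `e
  -- i`.
  have hout : ∀ i, ∀ y ∈ U \ M, ∀ c, G.edge c (e i) y → c = k i := fun i y hy c hc => by
    rw [hkσ i]
    exact hloop _ (he _) _ _ (hMU' c _ (he i) y hy hc _) (hk _)
  have hhom : ∀ i c, ∀ y ∈ U \ M, G.edge c (e i) y ↔ G.edge c (e i) (e i) := by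
    intro i c y hy
    constructor
    · intro hc
      rw [hout i y hy c hc]; exact hk i
    · intro hc
      obtain ⟨d, hd⟩ := hG.exists_edge (e i) y
      rwa [hloop _ (he i) _ _ hc (hk i), ← hout i y hy d hd]
  have hst : ∀ i, G.edge (k i) (e false) (e true) := by
    intro i
    have hall := hMU' (k i) _ (he i) y₀ hy₀ ((hhom i _ y₀ hy₀).2 (hk i))
    cases hj : σ (e i)
    · simpa [hj] using hall true
    · simpa [hj] using G.edge_comm.1 (hall false)
  -- If the pair is a star-edge, it is the new last part. Otherwise its edge and both loops have a
  -- single common colour, and `M` collapses to the looped vertex `e false`.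
  by_cases hstar : ∀ c, G.edge c (e false) (e true)
  · have hne : e false ≠ e true := by
      intro heq
      rw [← heq] at hstar
      exact absurd (hloop _ (he false) _ _ (hstar true) (hstar false)) (by decide)
    have hinj : Function.Injective e := by
      rintro (_ | _) (_ | _) hij
      exacts [rfl, absurd hij hne, absurd hij.symm hne, rfl]
    refine h.of_diff hMU (A := Set.range e) (fun x ⟨i, hi⟩ => hi ▸ he i) (fun x => e (σ x))
      (fun x _ => ⟨_, rfl⟩) hMM (fun c x hx y hy hxy => hMU' c x hx y hy hxy _) ?_ (.inr ⟨?_, ?_, ?_⟩)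
    · rintro c _ ⟨i, rfl⟩ y hy
      exact hhom i c y hy
    · rw [Nat.card_range_of_injective hinj]
      simp
    · rw [isReflexive_iff]
      exact fun v => (hG.exists_edge v v).imp fun c hc => (edge_induce _ _ _ _ _).2 hc
    · rintro ⟨_, i, rfl⟩ ⟨_, j, rfl⟩ hij
      have hij' : i ≠ j := fun h => hij (by simp [h])
      have : ∀ c, G.edge c (e i) (e j) := by
        intro c
        cases i <;> cases j
        exacts [absurd rfl hij', hstar c, G.edge_comm.1 (hstar c), absurd rfl hij']
      exact ⟨this true, this false⟩
  · have huniq : ∀ c, G.edge c (e false) (e true) → c = k false := by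
      intro c hc
      by_contra hne
      refine hstar fun d => ?_
      rcases Bool.eq_or_eq_not d c with rfl | h
      · exact hc
      · rw [h, show (!c) = k false by revert hne; cases c <;> cases k false <;> simp]
        exact hst false
    have hcol : ∀ c i j, G.edge c (e i) (e j) → G.edge c (e false) (e false) := by
      intro c i j hc
      have : c = k false := by
        cases i <;> cases j
        · exact hloop _ (he _) _ _ hc (hk _)
        · exact huniq c hc
        · exact huniq c (G.edge_comm.1 hc)
        · rw [hloop _ (he _) _ _ hc (hk _)]
          exact huniq _ (hst true)
      rw [this]; exact hk false
    refine h.of_diff hMU (A := {e false}) (by simpa using he false) (fun _ => e false)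
      (fun x _ => rfl) (fun c x hx y hy hxy => hcol c _ _ (hMM c x hx y hy hxy))
      (fun c x hx y hy hxy => hcol c _ (σ x) (hMU' c x hx y hy hxy _)) ?_ (.inl ⟨by simp, ?_⟩)
    · rintro c _ rfl y hy
      exact hhom false c y hy
    · rw [isReflexive_iff]
      exact fun v => (hG.exists_edge v v).imp fun c hc => (edge_induce _ _ _ _ _).2 hc

theorem dec_diff_peelSet_iff {G : ECGraph V} (hG : G.IsReflexiveComplete) {U : Set V}
    {e : Bool → V} (he : ∀ i, e i ∈ G.peelSet U e) : G.Dec (U \ G.peelSet U e) ↔ G.Dec U :=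
  ⟨.of_diff_peelSet hG he, fun h => h.diff_peelSet e⟩

/-! ### Existence of a pair that allows peeling. -/

/-- A nonempty concatenation has a last part. -/
theorem IsConcatenation.exists_last {G : ECGraph W} (hG : G.IsConcatenation) [Nonempty W] :
    ∃ a : Bool → W, ∀ x ∉ Set.range a, (∀ i c, G.edge c (a i) x → G.edge c (a i) (a i)) ∧
      (a false = a true ∨ ∀ c, G.edge c (a false) (a true)) := by
  have henum : ∀ {Y : Type} [Nonempty Y], Finite Y → Nat.card Y ≤ 2 →
      ∃ a : Bool → Y, Function.Surjective a := by
    intro Y _ _ hY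
    have := Fintype.ofFinite Y
    rw [Nat.card_eq_fintype_card] at hY
    obtain ⟨g⟩ := Function.Embedding.nonempty_of_card_le (α := Y) (β := Bool) (by simpa using hY)
    exact ⟨Function.invFun g, Function.invFun_surjective g.injective⟩
  cases hG with
  | base A hfin hcard =>
    obtain ⟨a, ha⟩ := henum hfin hcard
    -- With a single part, no vertex lies outside the range of `a`.
    exact ⟨a, fun x hx => absurd (ha x) hx⟩
  | @concat X Y G A hG hA =>
    have hpos : Nat.card Y ≠ 0 := by rcases hA with h | h <;> rw [h.1] <;> decide
    have hfin : Finite Y := Nat.finite_of_card_ne_zero hpos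
    have : Nonempty Y := (Nat.card_ne_zero.1 hpos).1
    obtain ⟨a, ha⟩ := henum hfin (by rcases hA with h | h <;> rw [h.1]; decide)
    refine ⟨fun i => .inr (a i), ?_⟩
    rintro (x | y) hx
    · refine ⟨fun i c h => ?_, ?_⟩
      · rw [edge_hconcat_inr_inl] at h
        rwa [edge_hconcat_inr_inr]
      · by_cases hne : a false = a true
        · exact .inl (congrArg _ hne)
        · right
          intro c
          rw [edge_hconcat_inr_inr]
          rcases hA with h | h
          · have := (Nat.card_eq_one_iff_unique.1 h.1).1
            exact absurd (Subsingleton.elim _ _) hne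
          · have := h.2.2 _ _ hne
            cases c
            exacts [this.2, this.1]
    · obtain ⟨i, rfl⟩ := ha y
      exact absurd ⟨i, rfl⟩ hx

/-- Let `e` enumerate the last part of a minimal image `S` of `f`. The literals that are true under
`f` are closed under implication, so every vertex that `f` sends to the last part is in the peel
set. The vertices `e i` themselves need not be sent there, but `f` permutes `S`, so some iterate
returns to `e i`, and membership pulls back along `f`. -/
theorem Dec.exists_mem_peelSet [Finite V] {G : ECGraph V} {U : Set V}
    (h : G.Dec U) (hne : U.Nonempty) : ∃ e : Bool → V, ∀ i, e i ∈ G.peelSet U e := by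
  obtain ⟨S, hSU, ⟨f, hf⟩, ⟨W, K, hK, hiso⟩, hbij⟩ := h.exists_minimal
  obtain ⟨ε, hε⟩ := isomorphic_iff.1 hiso
  have : Nonempty W := by
    obtain ⟨u, hu⟩ := hne
    exact ⟨ε.symm ⟨f u, hf.1 hu⟩⟩
  obtain ⟨b, hb⟩ := hK.exists_last
  let e : Bool → V := fun i => ε (b i)
  have heS : ∀ i, e i ∈ S := fun i => (ε (b i)).2
  have hlast : ∀ x ∈ S, x ∉ Set.range e → (∀ i c, G.edge c (e i) x → G.edge c (e i) (e i)) ∧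
      (e false = e true ∨ ∀ c, G.edge c (e false) (e true)) := by
    intro x hx hxe
    have hx' : ε.symm ⟨x, hx⟩ ∉ Set.range b := by
      rintro ⟨i, hi⟩
      exact hxe ⟨i, by simp [e, hi]⟩
    have hedge : ∀ c w w', K.edge c w w' ↔ G.edge c (ε w) (ε w') := fun c w w' => by
      rw [hε, edge_induce]
    obtain ⟨h₁, h₂⟩ := hb _ hx'
    refine ⟨fun i c => ?_, h₂.imp (fun h => by simp [e, h]) fun h c => (hedge _ _ _).1 (h c)⟩
    simpa [hedge] using h₁ i c
  -- If `e false = e true`, no implication starts at a true literal; this is what excludes a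
  -- contradiction when the last part is a single vertex.
  have hstep : ∀ y j, f y = e j → ∀ z l, G.Step U e (y, j) (z, l) →
      f z = e l ∧ e false ≠ e true := by
    rintro y j hy z l ⟨hyU, hzU, c, h₁, h₂⟩
    have h₃ := hf.2 c y hyU z hzU h₁
    rw [hy] at h₃
    simp only at h₂
    by_cases hz : f z ∈ Set.range e
    · obtain ⟨m, hm⟩ := hz
      have hml : m = l := by
        by_contra hml
        rw [← hm, show m = !l by revert hml; cases m <;> cases l <;> simp] at h₃
        exact h₂ h₃
      refine ⟨by rw [← hm, hml], fun heq => ?_⟩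
      have hconst : ∀ i i', e i = e i' := by
        rintro (_ | _) (_ | _)
        exacts [rfl, heq, heq.symm, rfl]
      rw [← hm, hconst m (!l)] at h₃
      exact h₂ h₃
    · obtain ⟨h₄, h₅⟩ := hlast _ (hf.1 hzU) hz
      have h₆ := h₄ j c h₃
      rcases h₅ with h₅ | h₅
      · have hconst : ∀ i i', e i = e i' := by
          rintro (_ | _) (_ | _)
          exacts [rfl, h₅, h₅.symm, rfl]
        rw [hconst (!l) j] at h₂
        exact absurd h₆ h₂
      · refine absurd ?_ h₂
        cases j <;> cases l
        exacts [h₅ c, h₆, h₆, G.edge_comm.1 (h₅ c)]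
  have hpre : ∀ x ∈ U, f x ∈ Set.range e → x ∈ G.peelSet U e := by
    rintro x hx ⟨i, hi⟩
    refine ⟨hx, i, fun hr => ?_⟩
    have key : ∀ q, ReflTransGen (G.Step U e) (x, i) q →
        f q.1 = e q.2 ∧ (q = (x, i) ∨ e false ≠ e true) := by
      intro q hq
      induction hq with
      | refl => exact ⟨hi.symm, .inl rfl⟩
      | @tail p q _ hpq ih =>
        have := hstep p.1 p.2 ih.1 q.1 q.2 hpq
        exact ⟨this.1, .inr this.2⟩
    obtain ⟨h₁, h₂⟩ := key _ hr
    rw [← hi] at h₁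
    rcases h₂ with h₂ | h₂
    · simp at h₂
    · cases i
      exacts [h₂ h₁, h₂ h₁.symm]
  refine ⟨e, fun i => ?_⟩
  have hfS : G.HomOn f S S := ⟨hf.1.mono_left hSU, fun c u hu v hv => hf.2 c u (hSU hu) v (hSU hv)⟩
  have hb := hbij f hfS
  obtain ⟨m, hm, hper⟩ := (Set.MapsTo.restrict_inj hfS.1).2 hb.injOn |>.mem_periodicPts ⟨e i, heS i⟩
  have hit : ∀ m, ∀ x ∈ S, f^[m] x ∈ S := fun m x hx => (hfS.1.iterate m) hx
  have hper' : f^[m] (e i) = e i := by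
    have := congrArg Subtype.val hper.eq
    rwa [Set.MapsTo.iterate_restrict] at this
  obtain ⟨m, rfl⟩ : ∃ m', m = m' + 1 := ⟨m - 1, by omega⟩
  have hback : ∀ m, ∀ x ∈ S, f^[m] x ∈ G.peelSet U e → x ∈ G.peelSet U e := by
    intro m
    induction m with
    | zero => exact fun x _ hx => hx
    | succ m ih =>
      intro x hx h
      exact mem_peelSet_of_hom hf hSU (hSU hx) (ih _ (hfS.1 hx) h)
  -- The predecessor of `e i` on its cycle is sent to `e i`, so it is in the peel set; `e i` reaches
  -- it by iterating `f`.
  refine hback m _ (heS i) (hpre _ (hSU (hit m _ (heS i))) ⟨i, ?_⟩)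
  rw [← Function.iterate_succ_apply' f, hper']

end ECGraph

/-! ### Invariants of loops and arrays that commands leave alone. -/

namespace RAM

theorem runLoop_invariant {α : Type} {G : ℕ → α → α} {n : ℕ} (I : ℕ → α → Prop) {a : α}
    (h0 : I 0 a) (hstep : ∀ v < n, ∀ b, I v b → I (v + 1) (G v b)) : I n (runLoop G n a) := by
  induction n with
  | zero => exact h0
  | succ n ih => exact hstep n (by omega) _ (ih fun v hv => hstep v (by omega))

theorem subset_runLoop {α ι : Type} {G : ℕ → α → α} (d : α → Set ι)
    (hG : ∀ v a, d a ⊆ d (G v a)) {m n : ℕ} (hmn : m ≤ n) (a : α) :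
    d (runLoop G m a) ⊆ d (runLoop G n a) := by
  induction n, hmn using Nat.le_induction with
  | base => exact le_rfl
  | succ n _ ih => exact ih.trans (hG n _)

/-- If a loop of increasing steps changes nothing, then no step changes anything. -/
theorem runLoop_unchanged {α ι : Type} {G : ℕ → α → α} (d : α → Set ι)
    (hG : ∀ v a, d a ⊆ d (G v a)) {n : ℕ} {a : α} (h : d (runLoop G n a) = d a) {v : ℕ}
    (hv : v < n) : d (runLoop G v a) = d a ∧ d (G v (runLoop G v a)) = d a :=
  ⟨(h ▸ subset_runLoop d hG hv.le a).antisymm (subset_runLoop d hG v.zero_le a),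
    (h ▸ subset_runLoop d hG (Nat.succ_le_of_lt hv) a : d (runLoop G (v + 1) a) ⊆ d a).antisymm
      (subset_runLoop d hG (v + 1).zero_le a)⟩

/-- A loop whose `v`-th step may insert `v` into array `a`. -/
theorem mem_runLoop_pointwise {G : ℕ → Store → Store} {n a : ℕ} (I : Store → Prop) (T : ℕ → Prop)
    {σ : Store} (h0 : I σ)
    (hstep : ∀ v < n, ∀ τ, I τ → I (G v τ) ∧ ∀ w, (a, w) ∈ G v τ ↔ (w = v ∧ T v) ∨ (a, w) ∈ τ) :
    I (runLoop G n σ) ∧ ∀ w, (a, w) ∈ runLoop G n σ ↔ (w < n ∧ T w) ∨ (a, w) ∈ σ := by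
  refine runLoop_invariant (fun v τ => I τ ∧ ∀ w, (a, w) ∈ τ ↔ (w < v ∧ T w) ∨ (a, w) ∈ σ)
    ⟨h0, by simp⟩ fun v hv τ hτ => ?_
  obtain ⟨h₁, h₂⟩ := hstep v hv τ hτ.1
  refine ⟨h₁, fun w => ?_⟩
  rw [h₂, hτ.2, ← or_assoc]
  refine or_congr_left ⟨?_, ?_⟩
  · rintro (⟨rfl, h⟩ | ⟨hw, h⟩)
    exacts [⟨by omega, h⟩, ⟨by omega, h⟩]
  · rintro ⟨hw, h⟩
    rcases Nat.lt_succ_iff_lt_or_eq.1 hw with hw | rfl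
    exacts [.inr ⟨hw, h⟩, .inl ⟨rfl, h⟩]

namespace Command

/-- No entry of array `a` is ever deleted. -/
def Keeps (a : ℕ) : Command → Prop
  | put _ _ => True
  | del b _ => b ≠ a
  | seq c d => c.Keeps a ∧ d.Keeps a
  | ite _ c => c.Keeps a
  | loop c => c.Keeps a

/-- Array `a` is never written. -/
def Avoids (a : ℕ) : Command → Prop
  | put b _ => b ≠ a
  | del b _ => b ≠ a
  | seq c d => c.Avoids a ∧ d.Avoids a
  | ite _ c => c.Avoids a
  | loop c => c.Avoids a

theorem mem_run_of_keeps {a : ℕ} {c : Command} (hc : c.Keeps a) {k i : ℕ} {ρ : ℕ → ℕ} {σ : Store}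
    (h : (a, i) ∈ σ) : (a, i) ∈ c.run k ρ σ := by
  induction c generalizing k ρ σ with
  | put b x => exact Set.mem_insert_of_mem _ h
  | del b x =>
    refine ⟨h, fun heq => hc ?_⟩
    exact (congrArg Prod.fst heq).symm
  | seq c d ih₁ ih₂ => exact ih₂ hc.2 (ih₁ hc.1 h)
  | ite φ c ih =>
    rw [run]
    split_ifs
    exacts [ih hc h, h]
  | loop c ih => exact runLoop_invariant (fun _ τ => (a, i) ∈ τ) h fun _ _ _ hτ => ih hc hτ

theorem mem_run_of_avoids {a : ℕ} {c : Command} (hc : c.Avoids a) {k i : ℕ} {ρ : ℕ → ℕ}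
    {σ : Store} : (a, i) ∈ c.run k ρ σ ↔ (a, i) ∈ σ := by
  induction c generalizing k ρ σ with
  | put b x => simp [run, hc.symm]
  | del b x => simp [run, hc.symm]
  | seq c d ih₁ ih₂ => rw [run, ih₂ hc.2, ih₁ hc.1]
  | ite φ c ih =>
    rw [run]
    split_ifs
    exacts [ih hc, Iff.rfl]
  | loop c ih =>
    exact runLoop_invariant (fun _ τ => (a, i) ∈ τ ↔ (a, i) ∈ σ) Iff.rfl
      fun _ _ _ hτ => (ih hc).trans hτ

end Command

end RAM

/-! ### The peeling procedure as a command. -/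

namespace Peeling

open ECGraph RAM Relation

variable {n : ℕ}

/-- The array that holds the edges of one colour. -/
def matrixArray (c : Bool) : ℕ := bif c then 0 else 1

/-- The array of the vertices `x` such that the literal `(x, i)` has been reached. -/
def literalArray (i : Bool) : ℕ := bif i then 5 else 4

/-- The register that holds the vertex `e i`. -/
def endRegister (i : Bool) : ℕ := bif i then 3 else 2

/-- The removed vertices. -/
def removed (n : ℕ) (σ : Store) : Set (Fin n) := {v | (2, (v : ℕ)) ∈ σ}

/-- The store contains the adjacency matrices of `H`. -/
def Encodes (H : ECGraph (Fin n)) (σ : Store) : Prop :=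
  ∀ c (i j : Fin n), (matrixArray c, (i : ℕ) * n + j) ∈ σ ↔ H.edge c i j

theorem Encodes.of_avoids {H : ECGraph (Fin n)} {σ : Store} (h : Encodes H σ) {c : Command}
    (h₀ : c.Avoids 0) (h₁ : c.Avoids 1) (k : ℕ) (ρ : ℕ → ℕ) : Encodes H (c.run k ρ σ) := by
  rintro (_ | _) i j
  · exact (Command.mem_run_of_avoids h₁).trans (h false i j)
  · exact (Command.mem_run_of_avoids h₀).trans (h true i j)

theorem removed_of_avoids {c : Command} (h : c.Avoids 2) (k : ℕ) (ρ : ℕ → ℕ) (σ : Store) :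
    removed n (c.run k ρ σ) = removed n σ :=
  Set.ext fun _ => Command.mem_run_of_avoids h

/-- The edge `y z` of colour `c` has no counterpart between `e j` and `e (!l)`. -/
def conflict (c j l : Bool) : Cond :=
  .and (.mat (matrixArray c) 6 7) (.not (.mat (matrixArray c) (endRegister j) (endRegister !l)))

/-- The literal `(y, j)` has been reached and implies the literal `(z, l)`. -/
def implied (j l : Bool) : Cond :=
  .and (.mem (literalArray j) 6) (.and (.not (.mem 2 6)) (.and (.not (.mem 2 7))
    (.not (.and (.not (conflict true j l)) (.not (conflict false j l))))))

/-- Registers: `0` holds `n`, `1` counts rounds, `2` and `3` hold the pair `e`, `4` holds `x`, `5`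
counts double passes, `6` and `7` hold `y` and `z`. Arrays: `0` and `1` are the matrices, `2` the
removed vertices, `3` the current peel set, `4` and `5` the literals, `6` the output. -/
def infer (j l : Bool) : Command := .ite (implied j l) (.put (literalArray l) 7)

def inferAll : Command :=
  .seq (.seq (infer false false) (infer false true)) (.seq (infer true false) (infer true true))

/-- Draw all conclusions from the literals reached so far. -/
def pass : Command := .loop (.loop inferAll)

/-- Compute the literals that are implied by the literal `(x, i)`. -/
def closure (i : Bool) : Command :=
  .seq (.loop (.seq (.del 4 5) (.del 5 5)))
    -- There are `2n` literals, whence two passes in each of `n` iterations.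
    (.seq (.put (literalArray i) 4) (.loop (.seq pass pass)))

/-- Mark `x` if the literal `(x, i)` is consistent. -/
def mark (i : Bool) : Command :=
  .seq (closure i) (.ite (.not (.mem (literalArray !i) 4)) (.put 3 4))

/-- Remove the peel set of `e` if it contains `e false` and `e true`. -/
def peel : Command :=
  .seq (.loop (.del 3 4)) (.seq (.loop (.ite (.not (.mem 2 4)) (.seq (mark false) (mark true))))
    (.ite (.and (.mem 3 2) (.mem 3 3)) (.loop (.ite (.mem 3 4) (.put 2 4)))))

/-- Peel with all pairs of vertices in turn. -/
def round : Command := .loop (.loop peel)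

/-- Peel as long as possible, and report whether a vertex is left. -/
def peelAll : Command :=
  -- The output flag is entry `n` of array `6`, since register `0` serves as the index.
  .seq (.loop round) (.loop (.ite (.not (.mem 2 1)) (.put 6 0)))

theorem holds_conflict {H : ECGraph (Fin n)} {σ : Store} (hσ : Encodes H σ) {ρ : ℕ → ℕ}
    {e : Bool → Fin n} (h0 : ρ 0 = n) (he : ∀ i, ρ (endRegister i) = e i) {y z : Fin n}
    (hy : ρ 6 = y) (hz : ρ 7 = z) (c j l : Bool) :
    (conflict c j l).Holds ρ σ ↔ H.edge c y z ∧ ¬ H.edge c (e j) (e !l) := by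
  simp only [conflict, Cond.Holds, h0, he, hy, hz, hσ c _ _]

theorem holds_implied {H : ECGraph (Fin n)} {σ : Store} (hσ : Encodes H σ) {ρ : ℕ → ℕ}
    {e : Bool → Fin n} (h0 : ρ 0 = n) (he : ∀ i, ρ (endRegister i) = e i) {y z : Fin n}
    (hy : ρ 6 = y) (hz : ρ 7 = z) (j l : Bool) :
    (implied j l).Holds ρ σ ↔
      (literalArray j, (y : ℕ)) ∈ σ ∧ H.Step (removed n σ)ᶜ e (y, j) (z, l) := by
  have := holds_conflict hσ h0 he hy hz
  simp only [implied, Cond.Holds, this, Step, Bool.exists_bool, hy, hz, removed, Set.mem_compl_iff,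
    Set.mem_ofPred_eq]
  tauto

/-! ### Correctness of the closure under implication. -/

/-- The literals that are recorded in a store. -/
def literals (n : ℕ) (σ : Store) : Set (Fin n × Bool) :=
  {p | (literalArray p.2, (p.1 : ℕ)) ∈ σ}

/-- The store describes `H`, the removed vertices are `D`, and all recorded literals are in `R`. -/
def Sound (H : ECGraph (Fin n)) (D : Set (Fin n)) (R : Set (Fin n × Bool)) (σ : Store) : Prop :=
  Encodes H σ ∧ removed n σ = D ∧ literals n σ ⊆ R

theorem literalArray_injective : Function.Injective literalArray := by
  rintro (_ | _) (_ | _) h <;> simp_all [literalArray]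

theorem infer_avoids (j l : Bool) (a : ℕ) (ha : a ≠ 4) (ha' : a ≠ 5) : (infer j l).Avoids a := by
  cases l
  exacts [ha.symm, ha'.symm]

theorem Sound.infer {H : ECGraph (Fin n)} {D : Set (Fin n)} {R : Set (Fin n × Bool)} {σ : Store}
    {e : Bool → Fin n} (hσ : Sound H D R σ) (hR : ∀ p ∈ R, ∀ q, H.Step Dᶜ e p q → q ∈ R)
    {ρ : ℕ → ℕ} (h0 : ρ 0 = n) (he : ∀ i, ρ (endRegister i) = e i) {y z : Fin n}
    (hy : ρ 6 = y) (hz : ρ 7 = z) (j l : Bool) (k : ℕ) :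
    Sound H D R ((infer j l).run k ρ σ) := by
  refine ⟨hσ.1.of_avoids (infer_avoids j l 0 (by simp) (by simp))
    (infer_avoids j l 1 (by simp) (by simp)) _ _,
    (removed_of_avoids (infer_avoids j l 2 (by simp) (by simp)) _ _ _).trans hσ.2.1, ?_⟩
  rw [Peeling.infer, Command.run]
  split_ifs with h
  · rw [holds_implied hσ.1 h0 he hy hz, hσ.2.1] at h
    rintro ⟨w, m⟩ (hw | hw)
    · simp only [Prod.mk.injEq, literalArray_injective.eq_iff, hz, Fin.val_inj] at hw
      obtain ⟨rfl, rfl⟩ := hw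
      exact hR _ (hσ.2.2 h.1) _ h.2
    · exact hσ.2.2 hw
  · exact hσ.2.2

theorem mem_run_infer {H : ECGraph (Fin n)} {σ : Store} {e : Bool → Fin n} (hσ : Encodes H σ)
    {ρ : ℕ → ℕ} (h0 : ρ 0 = n) (he : ∀ i, ρ (endRegister i) = e i) {y z : Fin n}
    (hy : ρ 6 = y) (hz : ρ 7 = z) {j l : Bool} (k : ℕ) (hj : (y, j) ∈ literals n σ)
    (hstep : H.Step (removed n σ)ᶜ e (y, j) (z, l)) :
    (literalArray l, (z : ℕ)) ∈ (infer j l).run k ρ σ := by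
  rw [infer, Command.run, if_pos ((holds_implied hσ h0 he hy hz j l).2 ⟨hj, hstep⟩)]
  exact .inl (by rw [hz])

theorem infer_keeps (j l : Bool) (a : ℕ) : (infer j l).Keeps a := trivial

theorem inferAll_keeps (a : ℕ) : inferAll.Keeps a := ⟨⟨trivial, trivial⟩, trivial, trivial⟩

theorem Sound.inferAll {H : ECGraph (Fin n)} {D : Set (Fin n)} {R : Set (Fin n × Bool)} {σ : Store}
    {e : Bool → Fin n} (hσ : Sound H D R σ) (hR : ∀ p ∈ R, ∀ q, H.Step Dᶜ e p q → q ∈ R)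
    {ρ : ℕ → ℕ} (h0 : ρ 0 = n) (he : ∀ i, ρ (endRegister i) = e i) {y z : Fin n}
    (hy : ρ 6 = y) (hz : ρ 7 = z) (k : ℕ) :
    Sound H D R (inferAll.run k ρ σ) := by
  have h := fun τ (hτ : Sound H D R τ) j l => hτ.infer hR h0 he hy hz j l k
  exact h _ (h _ (h _ (h _ hσ _ _) _ _) _ _) _ _

theorem mem_run_inferAll {H : ECGraph (Fin n)} {D : Set (Fin n)} {σ : Store}
    {e : Bool → Fin n} (hσ : Sound H D Set.univ σ)
    {ρ : ℕ → ℕ} (h0 : ρ 0 = n) (he : ∀ i, ρ (endRegister i) = e i) {y z : Fin n}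
    (hy : ρ 6 = y) (hz : ρ 7 = z) {j l : Bool} (k : ℕ) (hj : (y, j) ∈ literals n σ)
    (hstep : H.Step Dᶜ e (y, j) (z, l)) :
    (literalArray l, (z : ℕ)) ∈ inferAll.run k ρ σ := by
  have hs := fun τ (hτ : Sound H D Set.univ τ) j l =>
    hτ.infer (e := e) (fun _ _ _ _ => trivial) h0 he hy hz j l k
  have hk := fun τ (hτ : (y, j) ∈ literals n τ) j l =>
    (Command.mem_run_of_keeps (infer_keeps j l _) hτ :
      (y, _) ∈ literals n ((infer j l).run k ρ τ))
  have hm := fun τ (hτ : Sound H D Set.univ τ) (h : (y, j) ∈ literals n τ) =>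
    mem_run_infer hτ.1 h0 he hy hz k h (by rw [hτ.2.1]; exact hstep)
  have h₁ := hs _ hσ false false
  have h₂ := hs _ h₁ false true
  have h₃ := hs _ h₂ true false
  have k₁ := hk _ hj false false
  have k₂ := hk _ k₁ false true
  have k₃ := hk _ k₂ true false
  have hk₂ := fun τ (h : (literalArray l, (z : ℕ)) ∈ τ) =>
    Command.mem_run_of_keeps (c := .seq (infer true false) (infer true true)) (k := k) (ρ := ρ)
      ⟨trivial, trivial⟩ h
  cases j <;> cases l
  · exact hk₂ _ (Command.mem_run_of_keeps (infer_keeps false true _) (hm _ hσ hj))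
  · exact hk₂ _ (hm _ h₁ k₁)
  · exact Command.mem_run_of_keeps (infer_keeps true true _) (hm _ h₂ k₂)
  · exact hm _ h₃ k₃

/-- Register `0` holds `n`, and the registers `2` and `3` hold the vertices `e false`, `e true`. -/
def Setup (ρ : ℕ → ℕ) (e : Bool → Fin n) : Prop :=
  ρ 0 = n ∧ ∀ i, ρ (endRegister i) = e i

theorem Setup.update {ρ : ℕ → ℕ} {e : Bool → Fin n} (h : Setup ρ e) {k : ℕ} (hk : 4 ≤ k) (v : ℕ) :
    Setup (Function.update ρ k v) e := by
  refine ⟨?_, fun i => ?_⟩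
  · rw [Function.update_of_ne (by omega)]
    exact h.1
  · have : endRegister i ≠ k := by cases i <;> simp [endRegister] <;> omega
    rw [Function.update_of_ne this]
    exact h.2 i

theorem Sound.pass {H : ECGraph (Fin n)} {D : Set (Fin n)} {R : Set (Fin n × Bool)} {σ : Store}
    {e : Bool → Fin n} (hσ : Sound H D R σ) (hR : ∀ p ∈ R, ∀ q, H.Step Dᶜ e p q → q ∈ R)
    {ρ : ℕ → ℕ} (hρ : Setup ρ e) : Sound H D R (pass.run 6 ρ σ) := by
  refine runLoop_invariant (fun _ => Sound H D R) hσ fun y hy τ hτ => ?_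
  have hρy := hρ.update (k := 6) (by omega) y
  refine runLoop_invariant (fun _ => Sound H D R) hτ fun z hz τ hτ => ?_
  have hρz := hρy.update (k := 7) (by omega) z
  rw [hρ.1] at hy
  rw [hρy.1] at hz
  exact hτ.inferAll hR hρz.1 hρz.2 (y := ⟨y, hy⟩) (z := ⟨z, hz⟩) (by simp) (by simp) _

theorem pass_keeps (a : ℕ) : pass.Keeps a := inferAll_keeps a

theorem literals_subset_run {c : Command} (h₄ : c.Keeps 4) (h₅ : c.Keeps 5) (k : ℕ) (ρ : ℕ → ℕ)
    (σ : Store) : literals n σ ⊆ literals n (c.run k ρ σ) := by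
  rintro ⟨y, _ | _⟩ h
  exacts [Command.mem_run_of_keeps h₄ h, Command.mem_run_of_keeps h₅ h]

/-- The premise is still recorded when the loops reach the pair of vertices of `p` and `q`, since
nothing is deleted; the conclusion drawn there persists for the same reason. -/
theorem mem_literals_pass {H : ECGraph (Fin n)} {D : Set (Fin n)} {σ : Store}
    {e : Bool → Fin n} (hσ : Sound H D Set.univ σ) {ρ : ℕ → ℕ} (hρ : Setup ρ e)
    {p q : Fin n × Bool} (hp : p ∈ literals n σ) (hstep : H.Step Dᶜ e p q) :
    q ∈ literals n (pass.run 6 ρ σ) := by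
  obtain ⟨y, j⟩ := p
  obtain ⟨z, l⟩ := q
  have hinv : ∀ ρ' k τ, Setup ρ' e → (∃ y : Fin n, ρ' 6 = y) → (∃ z : Fin n, ρ' 7 = z) →
      Sound H D Set.univ τ ∧ (y, j) ∈ literals n τ →
      Sound H D Set.univ (inferAll.run k ρ' τ) ∧ (y, j) ∈ literals n (inferAll.run k ρ' τ) :=
    fun ρ' k τ hρ' ⟨y', hy'⟩ ⟨z', hz'⟩ hτ =>
      ⟨hτ.1.inferAll (e := e) (fun _ _ _ _ => trivial) hρ'.1 hρ'.2 hy' hz' k,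
        Command.mem_run_of_keeps (inferAll_keeps _) hτ.2⟩
  have hρ₁ := fun w : ℕ => hρ.update (k := 6) (by omega) w
  have hρ₂ := fun w w' : ℕ => (hρ₁ w).update (k := 7) (by omega) w'
  have hinner : ∀ w < n, ∀ m ≤ n, ∀ τ, Sound H D Set.univ τ ∧ (y, j) ∈ literals n τ →
      let τ' := runLoop (fun v => inferAll.run 8 (Function.update (Function.update ρ 6 w) 7 v)) m τ
      Sound H D Set.univ τ' ∧ (y, j) ∈ literals n τ' := by
    intro w hw m hm τ hτ
    exact runLoop_invariant (fun _ τ => Sound H D Set.univ τ ∧ (y, j) ∈ literals n τ) hτ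
      fun v hv τ hτ => hinv _ _ τ (hρ₂ w v) ⟨⟨w, hw⟩, by simp⟩ ⟨⟨v, by omega⟩, by simp⟩ hτ
  have houter := runLoop_invariant
    (G := fun v => (Command.loop inferAll).run 7 (Function.update ρ 6 v)) (n := y)
    (fun _ τ => Sound H D Set.univ τ ∧ (y, j) ∈ literals n τ) ⟨hσ, hp⟩
    fun w hw τ hτ => hinner w (hw.trans y.2) _ (hρ₁ w).1.le τ hτ
  refine subset_runLoop (fun τ : Store => {i | (literalArray l, i) ∈ τ})
    (fun w τ j hj => Command.mem_run_of_keeps (c := .loop inferAll) (inferAll_keeps _) hj)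
    (Nat.succ_le_of_lt (y.2.trans_eq hρ.1.symm)) σ ?_
  refine subset_runLoop (fun τ : Store => {i | (literalArray l, i) ∈ τ})
    (fun w τ j hj => Command.mem_run_of_keeps (inferAll_keeps _) hj)
    (Nat.succ_le_of_lt (z.2.trans_eq (hρ₁ y).1.symm)) _ ?_
  have h := hinner y y.2 z z.2.le _ houter
  exact mem_run_inferAll h.1 (hρ₂ y z).1 (hρ₂ y z).2 (by simp) (by simp) 8 h.2 hstep

theorem exists_step_of_reflTransGen {α : Type} {r : α → α → Prop} {S : Set α} {a b : α}
    (h : ReflTransGen r a b) (ha : a ∈ S) (hb : b ∉ S) :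
    ∃ p ∈ S, ∃ q ∉ S, r p q := by
  induction h with
  | refl => exact absurd ha hb
  | @tail p q _ hpq ih =>
    by_cases h : p ∈ S
    · exact ⟨p, h, q, hb, hpq⟩
    · exact ih h

/-- The literals are sound, and all reachable literals are recorded or there are at least `m`
recorded literals. -/
def Progress (H : ECGraph (Fin n)) (D : Set (Fin n)) (e : Bool → Fin n) (p : Fin n × Bool) (m : ℕ)
    (σ : Store) : Prop :=
  Sound H D {q | ReflTransGen (H.Step Dᶜ e) p q} σ ∧ p ∈ literals n σ ∧
    ({q | ReflTransGen (H.Step Dᶜ e) p q} ⊆ literals n σ ∨ m ≤ (literals n σ).ncard)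

/-- If a reachable literal is missing, a path to it leaves the recorded set at some step, and the
pass records the endpoint of that step. -/
theorem Progress.pass {H : ECGraph (Fin n)} {D : Set (Fin n)} {e : Bool → Fin n}
    {p : Fin n × Bool} {m : ℕ} {σ : Store} (h : Progress H D e p m σ) {ρ : ℕ → ℕ}
    (hρ : Setup ρ e) : Progress H D e p (m + 1) (Peeling.pass.run 6 ρ σ) := by
  obtain ⟨hs, hp, hor⟩ := h
  have hsub : literals n σ ⊆ literals n (Peeling.pass.run 6 ρ σ) :=
    literals_subset_run (pass_keeps 4) (pass_keeps 5) 6 ρ σ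
  refine ⟨hs.pass (fun q hq r hr => ReflTransGen.tail hq hr) hρ, hsub hp, ?_⟩
  rcases hor with hor | hor
  · exact .inl (hor.trans hsub)
  · by_cases hall : {q | ReflTransGen (H.Step Dᶜ e) p q} ⊆ literals n σ
    · exact .inl (hall.trans hsub)
    · obtain ⟨r, hr, hrn⟩ := Set.not_subset.1 hall
      obtain ⟨q, hq, q', hq', hstep⟩ := exists_step_of_reflTransGen hr hp hrn
      have hmem := mem_literals_pass (D := D) ⟨hs.1, hs.2.1, Set.subset_univ _⟩ hρ hq hstep
      refine .inr (Nat.succ_le_of_lt (hor.trans_lt (Set.ncard_lt_ncard ?_ (Set.toFinite _))))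
      exact ⟨hsub, fun h => hq' (h hmem)⟩

theorem closure_avoids (i : Bool) (a : ℕ) (h₄ : a ≠ 4) (h₅ : a ≠ 5) : (closure i).Avoids a := by
  have h : ∀ j l, (infer j l).Avoids a := fun j l => infer_avoids j l a h₄ h₅
  refine ⟨⟨h₄.symm, h₅.symm⟩, ?_, ?_⟩
  · cases i
    exacts [h₄.symm, h₅.symm]
  · exact ⟨⟨⟨h _ _, h _ _⟩, h _ _, h _ _⟩, ⟨h _ _, h _ _⟩, h _ _, h _ _⟩

theorem literals_closure {H : ECGraph (Fin n)} {D : Set (Fin n)} {σ : Store} (hσ : Encodes H σ)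
    (hD : removed n σ = D) {e : Bool → Fin n} {ρ : ℕ → ℕ} (hρ : Setup ρ e) {x : Fin n}
    (hx : ρ 4 = x) (i : Bool) : literals n ((closure i).run 5 ρ σ) =
      {q | ReflTransGen (H.Step Dᶜ e) (x, i) q} := by
  set σ₁ := (Command.loop (.seq (.del 4 5) (.del 5 5))).run 5 ρ σ with hσ₁
  have hempty : literals n σ₁ = ∅ := by
    have : ∀ w < ρ 0, (4, w) ∉ σ₁ ∧ (5, w) ∉ σ₁ := by
      refine runLoop_invariant (fun v τ => ∀ w < v, (4, w) ∉ τ ∧ (5, w) ∉ τ) (by simp) ?_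
      intro v hv τ hτ w hw
      rcases Nat.lt_succ_iff_lt_or_eq.1 hw with hw | rfl
      · have := hτ w hw
        simp [Command.run, this]
      · simp [Command.run]
    refine Set.eq_empty_of_forall_notMem ?_
    rintro ⟨y, _ | _⟩ hy
    · exact (this y (y.2.trans_eq hρ.1.symm)).1 hy
    · exact (this y (y.2.trans_eq hρ.1.symm)).2 hy
  set σ₂ := (Command.put (literalArray i) 4).run 5 ρ σ₁ with hσ₂
  have hlit : literals n σ₂ = {(x, i)} := by
    ext ⟨y, j⟩
    have hy : (literalArray j, (y : ℕ)) ∉ σ₁ := fun h => (hempty ▸ h : (y, j) ∈ (∅ : Set _))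
    simp [literals, hσ₂, Command.run, hx, hy, literalArray_injective.eq_iff, Fin.val_inj, and_comm]
  have hav : ∀ a, a ≠ 4 → a ≠ 5 → ∀ j, (a, j) ∈ σ₂ ↔ (a, j) ∈ σ := by
    intro a h₄ h₅ j
    refine Command.mem_run_of_avoids (c := .seq (.loop (.seq (.del 4 5) (.del 5 5)))
      (.put (literalArray i) 4)) ⟨⟨h₄.symm, h₅.symm⟩, ?_⟩
    cases i
    exacts [h₄.symm, h₅.symm]
  have h0 : Progress H D e (x, i) 0 σ₂ := by
    refine ⟨⟨?_, ?_, ?_⟩, by simp [hlit], .inr (Nat.zero_le _)⟩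
    · intro c u v
      rw [hav _ (by cases c <;> simp [matrixArray]) (by cases c <;> simp [matrixArray])]
      exact hσ c u v
    · rw [← hD]
      exact Set.ext fun v => hav 2 (by simp) (by simp) v
    · rw [hlit]
      rintro _ rfl
      exact ReflTransGen.refl
  have hfin := runLoop_invariant
    (G := fun v => (Command.seq pass pass).run 6 (Function.update ρ 5 v)) (n := ρ 0)
    (fun v => Progress H D e (x, i) (2 * v)) h0 fun v _ τ hτ =>
      (hτ.pass (hρ.update (by omega) v)).pass (hρ.update (by omega) v)
  obtain ⟨hs, -, hor⟩ := hfin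
  refine hs.2.2.antisymm (hor.elim id fun hcard => ?_)
  -- After `2n` passes, the alternative to closedness is that all `2n` literals are recorded.
  refine (Set.subset_univ _).trans (Set.eq_of_subset_of_ncard_le (Set.subset_univ _) ?_).ge
  rw [Set.ncard_univ, Nat.card_eq_fintype_card, Fintype.card_prod, Fintype.card_fin,
    Fintype.card_bool, mul_comm]
  exact (congrArg (2 * ·) hρ.1).ge.trans hcard

/-! ### Correctness of peeling with one pair. -/

theorem mem_run_mark {H : ECGraph (Fin n)} {D : Set (Fin n)} {σ : Store} (hσ : Encodes H σ)
    (hD : removed n σ = D) {e : Bool → Fin n} {ρ : ℕ → ℕ} (hρ : Setup ρ e) {x : Fin n}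
    (hx : ρ 4 = x) (i : Bool) (w : ℕ) : (3, w) ∈ (mark i).run 5 ρ σ ↔
      (w = x ∧ ¬ ReflTransGen (H.Step Dᶜ e) (x, i) (x, !i)) ∨ (3, w) ∈ σ := by
  have hlit : (literalArray !i, ρ 4) ∈ (closure i).run 5 ρ σ ↔
      ReflTransGen (H.Step Dᶜ e) (x, i) (x, !i) := by
    rw [hx]
    exact Set.ext_iff.1 (literals_closure hσ hD hρ hx i) (x, !i)
  have hav : (3, w) ∈ (closure i).run 5 ρ σ ↔ (3, w) ∈ σ :=
    Command.mem_run_of_avoids (closure_avoids i 3 (by simp) (by simp))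
  rw [mark, Command.run, Command.run, Cond.Holds, Cond.Holds, hlit]
  by_cases h : ReflTransGen (H.Step Dᶜ e) (x, i) (x, !i)
  · simp [h, hav]
  · simp [h, hav, Command.run, hx]

theorem mark_avoids (i : Bool) (a : ℕ) (h₃ : a ≠ 3) (h₄ : a ≠ 4) (h₅ : a ≠ 5) :
    (mark i).Avoids a :=
  ⟨closure_avoids i a h₄ h₅, h₃.symm⟩

-- Marking writes only to arrays `3`, `4` and `5`, so all vertices are tested against the same set
-- `D`; vertices are removed only in the final loop.
open Classical in
theorem removed_peel {H : ECGraph (Fin n)} {D : Set (Fin n)} {σ : Store} (hσ : Encodes H σ)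
    (hD : removed n σ = D) {e : Bool → Fin n} {ρ : ℕ → ℕ} (hρ : Setup ρ e) :
    removed n (peel.run 4 ρ σ) =
      if ∀ i, e i ∈ H.peelSet Dᶜ e then D ∪ H.peelSet Dᶜ e else D := by
  set σ₁ := (Command.loop (.del 3 4)).run 4 ρ σ with hσ₁
  have hempty : ∀ w < n, (3, w) ∉ σ₁ := by
    have : ∀ w < ρ 0, (3, w) ∉ σ₁ := by
      refine runLoop_invariant (fun v τ => ∀ w < v, (3, w) ∉ τ) (by simp) ?_
      intro v hv τ hτ w hw
      rcases Nat.lt_succ_iff_lt_or_eq.1 hw with hw | rfl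
      · have := hτ w hw
        simp [Command.run, this]
      · simp [Command.run]
    rwa [hρ.1] at this
  have hav₁ : ∀ a ≠ 3, (Command.loop (.del 3 4)).Avoids a := fun a ha => ha.symm
  have hσ₁e : Encodes H σ₁ := hσ.of_avoids (hav₁ 0 (by simp)) (hav₁ 1 (by simp)) _ _
  have hσ₁d : removed n σ₁ = D := (removed_of_avoids (hav₁ 2 (by simp)) _ _ _).trans hD
  set c₂ : Command := .ite (.not (.mem 2 4)) (.seq (mark false) (mark true)) with hc₂
  have hav₂ : ∀ a, a ≠ 3 → a ≠ 4 → a ≠ 5 → c₂.Avoids a := fun a h₃ h₄ h₅ =>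
    ⟨mark_avoids false a h₃ h₄ h₅, mark_avoids true a h₃ h₄ h₅⟩
  set σ₂ := (Command.loop c₂).run 4 ρ σ₁ with hσ₂
  have key : (Encodes H σ₂ ∧ removed n σ₂ = D) ∧ ∀ w, (3, w) ∈ σ₂ ↔
      (w < ρ 0 ∧ ∃ hw : w < n, (⟨w, hw⟩ : Fin n) ∈ H.peelSet Dᶜ e) ∨ (3, w) ∈ σ₁ := by
    refine mem_runLoop_pointwise (fun τ => Encodes H τ ∧ removed n τ = D)
      (fun w => ∃ hw : w < n, (⟨w, hw⟩ : Fin n) ∈ H.peelSet Dᶜ e) ⟨hσ₁e, hσ₁d⟩ ?_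
    intro v hv τ ⟨hτ, hτD⟩
    rw [hρ.1] at hv
    refine ⟨⟨hτ.of_avoids (hav₂ 0 (by simp) (by simp) (by simp)) (hav₂ 1 (by simp) (by simp)
      (by simp)) _ _, (removed_of_avoids (hav₂ 2 (by simp) (by simp) (by simp)) _ _ _).trans hτD⟩,
      fun w => ?_⟩
    have hρ' := hρ.update (k := 4) le_rfl v
    have hv' : (Cond.mem 2 4).Holds (Function.update ρ 4 v) τ ↔ (⟨v, hv⟩ : Fin n) ∈ D := by
      rw [← hτD]
      simp [Cond.Holds, removed]
    have hm := fun i => mark_avoids i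
    rw [hc₂, Command.run, Cond.Holds, hv', Command.run]
    by_cases h : (⟨v, hv⟩ : Fin n) ∈ D
    · have : ¬ ∃ hw : v < n, (⟨v, hw⟩ : Fin n) ∈ H.peelSet Dᶜ e := fun ⟨_, hmem⟩ => hmem.1 h
      simp [this, h]
    · rw [if_pos h, mem_run_mark (D := D) (hτ.of_avoids (hm _ 0 (by simp) (by simp) (by simp))
        (hm _ 1 (by simp) (by simp) (by simp)) _ _) ((removed_of_avoids
        (hm _ 2 (by simp) (by simp) (by simp)) _ _ _).trans hτD) hρ' (x := ⟨v, hv⟩) (by simp),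
        mem_run_mark hτ hτD hρ' (x := ⟨v, hv⟩) (by simp), ← or_assoc]
      refine or_congr_left ?_
      simp only [peelSet, Set.mem_ofPred_eq, Set.mem_compl_iff, h, not_false_eq_true, true_and,
        Bool.exists_bool, hv, exists_true_left]
      tauto
  have hM : ∀ v : Fin n, (3, (v : ℕ)) ∈ σ₂ ↔ v ∈ H.peelSet Dᶜ e := by
    intro v
    rw [key.2, hρ.1]
    simp [hempty v v.2]
  have hcond : (Cond.and (.mem 3 2) (.mem 3 3)).Holds ρ σ₂ ↔ ∀ i, e i ∈ H.peelSet Dᶜ e := by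
    have h₂ : ρ 2 = e false := hρ.2 false
    have h₃ : ρ 3 = e true := hρ.2 true
    simp only [Cond.Holds, h₂, h₃, hM, Bool.forall_bool]
  have hrun : peel.run 4 ρ σ = if (∀ i, e i ∈ H.peelSet Dᶜ e) then
      (Command.loop (.ite (.mem 3 4) (.put 2 4))).run 4 ρ σ₂ else σ₂ := by
    change Command.run 4 (.ite _ _) ρ σ₂ = _
    rw [Command.run]
    by_cases h : ∀ i, e i ∈ H.peelSet Dᶜ e
    · rw [if_pos (hcond.2 h), if_pos h]
    · rw [if_neg (mt hcond.1 h), if_neg h]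
  rw [hrun]
  split_ifs with h
  · have hlast := (mem_runLoop_pointwise
      (G := fun v => (Command.ite (.mem 3 4) (.put 2 4)).run 5 (Function.update ρ 4 v))
      (n := ρ 0) (a := 2) (fun τ => ∀ w, (3, w) ∈ τ ↔ (3, w) ∈ σ₂) (fun w => (3, w) ∈ σ₂)
      (σ := σ₂) (fun _ => Iff.rfl) ?_).2
    · ext v
      refine (hlast v).trans ?_
      rw [hρ.1, hM, or_comm]
      have : (2, (v : ℕ)) ∈ σ₂ ↔ v ∈ D := by rw [← key.1.2]; rfl
      simp [this]
    · intro v hv τ hτ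
      refine ⟨fun w => (Command.mem_run_of_avoids (c := .ite (.mem 3 4) (.put 2 4))
        (show 2 ≠ 3 by simp)).trans (hτ w), fun w => ?_⟩
      rw [Command.run, Cond.Holds, Function.update_self, hτ v]
      split_ifs with hv3 <;> simp [hv3, Command.run]
  · exact key.1.2

theorem peel_avoids (a : ℕ) (h₂ : a ≠ 2) (h₃ : a ≠ 3) (h₄ : a ≠ 4) (h₅ : a ≠ 5) :
    peel.Avoids a :=
  ⟨h₃.symm, ⟨mark_avoids _ a h₃ h₄ h₅, mark_avoids _ a h₃ h₄ h₅⟩, h₂.symm⟩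

theorem peel_keeps : peel.Keeps 2 := by
  simp [peel, mark, closure, pass, inferAll, infer, Command.Keeps]

/-! ### Rounds of peeling and termination. -/

/-- No pair of remaining vertices allows peeling. -/
def Stuck (H : ECGraph (Fin n)) (D : Set (Fin n)) : Prop :=
  ∀ e : Bool → Fin n, ¬ ∀ i, e i ∈ H.peelSet Dᶜ e

/-- The store describes `H`, and removing vertices has not changed the answer. -/
def Valid (H : ECGraph (Fin n)) (σ : Store) : Prop :=
  Encodes H σ ∧ (H.Dec (removed n σ)ᶜ ↔ H.Dec Set.univ)

theorem Valid.peel {H : ECGraph (Fin n)} (hH : H.IsReflexiveComplete) {σ : Store}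
    (hσ : Valid H σ) {e : Bool → Fin n} {ρ : ℕ → ℕ} (hρ : Setup ρ e) :
    Valid H (peel.run 4 ρ σ) := by
  refine ⟨hσ.1.of_avoids (peel_avoids 0 (by simp) (by simp) (by simp) (by simp))
    (peel_avoids 1 (by simp) (by simp) (by simp) (by simp)) _ _, ?_⟩
  rw [removed_peel hσ.1 rfl hρ, ← hσ.2]
  split_ifs with h
  · rw [Set.compl_union, ← Set.sdiff_eq]
    exact dec_diff_peelSet_iff hH h
  · exact Iff.rfl

theorem setup_pair {ρ : ℕ → ℕ} (h0 : ρ 0 = n) (s t : Fin n) :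
    Setup (Function.update (Function.update ρ 2 s) 3 t) (fun i => bif i then t else s) := by
  refine ⟨by simpa using h0, ?_⟩
  rintro (_ | _) <;> simp [endRegister]

/-- An invariant of peeling is an invariant of a round. -/
theorem round_invariant (I : Store → Prop) {ρ : ℕ → ℕ} (h0 : ρ 0 = n)
    (hI : ∀ (e : Bool → Fin n) ρ' τ, Setup ρ' e → I τ → I (peel.run 4 ρ' τ)) {σ : Store}
    (hσ : I σ) {m : ℕ} (hm : m ≤ n) :
    I (runLoop (fun s => (Command.loop peel).run 3 (Function.update ρ 2 s)) m σ) := by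
  refine runLoop_invariant (fun _ => I) hσ fun s hs τ hτ => ?_
  refine runLoop_invariant (fun _ => I) hτ fun t ht τ hτ => ?_
  rw [Function.update_of_ne (by simp), h0] at ht
  exact hI _ _ τ (setup_pair h0 ⟨s, by omega⟩ ⟨t, ht⟩) hτ

/-- The removed set only grows, so a round without net change left it unchanged at every moment.
Each pair was therefore tested against this very set, and a successful test would have removed `e
false`. -/
theorem stuck_of_removed_round {H : ECGraph (Fin n)} (hH : H.IsReflexiveComplete) {σ : Store}
    (hσ : Valid H σ) {ρ : ℕ → ℕ} (h0 : ρ 0 = n)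
    (h : removed n (round.run 2 ρ σ) = removed n σ) : Stuck H (removed n σ) := by
  intro e he
  have hs : ∀ ρ' : ℕ → ℕ, ∀ v τ, removed n τ ⊆
      removed n ((Command.loop peel).run 3 (Function.update ρ' 2 v) τ) :=
    fun ρ' v τ w hw => Command.mem_run_of_keeps (c := .loop peel) peel_keeps hw
  have ht : ∀ ρ' : ℕ → ℕ, ∀ v τ, removed n τ ⊆ removed n (peel.run 4 (Function.update ρ' 3 v) τ) :=
    fun ρ' v τ w hw => Command.mem_run_of_keeps peel_keeps hw
  obtain ⟨h₁, h₂⟩ := runLoop_unchanged (removed n) (hs ρ) h ((e false).2.trans_eq h0.symm)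
  set τ := runLoop (fun s => (Command.loop peel).run 3 (Function.update ρ 2 s)) (e false) σ
  have hτ : Valid H τ := round_invariant (Valid H) h0 (fun e ρ' τ hρ' hτ => hτ.peel hH hρ') hσ
    (e false).2.le
  set ρ₁ := Function.update ρ 2 (e false : ℕ)
  have h0₁ : ρ₁ 0 = n := by simpa [ρ₁] using h0
  obtain ⟨h₃, h₄⟩ := runLoop_unchanged (removed n) (ht ρ₁) (h₂.trans h₁.symm)
    ((e true).2.trans_eq h0₁.symm)
  set τ' := runLoop (fun t => peel.run 4 (Function.update ρ₁ 3 t)) (e true) τ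
  have hτ' : Valid H τ' := by
    refine runLoop_invariant (fun _ => Valid H) hτ fun t ht τ hτ => ?_
    exact hτ.peel hH (setup_pair h0 (e false) ⟨t, ht.trans (e true).2⟩)
  have hee : (fun i => bif i then e true else e false) = e := by
    funext i
    cases i <;> rfl
  have hρ₂ := setup_pair h0 (e false) (e true)
  rw [hee] at hρ₂
  rw [removed_peel hτ'.1 (h₃.trans h₁) hρ₂, if_pos he, h₁] at h₄
  exact (he false).1 (h₄ ▸ .inr (he false))

theorem removed_round_of_stuck {H : ECGraph (Fin n)} (hH : H.IsReflexiveComplete) {σ : Store}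
    (hσ : Valid H σ) {ρ : ℕ → ℕ} (h0 : ρ 0 = n) (h : Stuck H (removed n σ)) :
    removed n (round.run 2 ρ σ) = removed n σ := by
  have := round_invariant (fun τ => Valid H τ ∧ removed n τ = removed n σ) h0
    (fun e ρ' τ hρ' hτ => ⟨hτ.1.peel hH hρ', by
      rw [removed_peel hτ.1.1 hτ.2 hρ', if_neg (h e)]⟩) ⟨hσ, rfl⟩ h0.le
  exact this.2

/-- Each round removes a vertex unless peeling is stuck, so after `n` rounds everything is removed
or peeling is stuck. In the stuck case `Dec` would provide a further pair if a vertex were left. -/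
theorem removed_eq_univ_iff {H : ECGraph (Fin n)} (hH : H.IsReflexiveComplete) {σ : Store}
    (hσ : Encodes H σ) (hD : removed n σ = ∅) {ρ : ℕ → ℕ} (h0 : ρ 0 = n) :
    removed n ((Command.loop round).run 1 ρ σ) = Set.univ ↔ H.Dec Set.univ := by
  have key := runLoop_invariant (G := fun v => round.run 2 (Function.update ρ 1 v)) (n := ρ 0)
    (fun m τ => Valid H τ ∧ (Stuck H (removed n τ) ∨ m ≤ (removed n τ).ncard)) (a := σ)
    ⟨⟨hσ, by simp [hD]⟩, .inr (Nat.zero_le _)⟩ (by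
    intro v _ τ ⟨hτ, hor⟩
    have h0' : Function.update ρ 1 v 0 = n := by simpa using h0
    have hτ' : Valid H (round.run 2 (Function.update ρ 1 v) τ) :=
      round_invariant (Valid H) h0' (fun e ρ' τ hρ' hτ => hτ.peel hH hρ') hτ h0'.le
    refine ⟨hτ', ?_⟩
    by_cases heq : removed n (round.run 2 (Function.update ρ 1 v) τ) = removed n τ
    · rw [heq]
      exact .inl (stuck_of_removed_round hH hτ h0' heq)
    · rcases hor with hor | hor
      · exact absurd (removed_round_of_stuck hH hτ h0' hor) heq
      · refine .inr (Nat.succ_le_of_lt (hor.trans_lt (Set.ncard_lt_ncard ?_ (Set.toFinite _))))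
        exact Set.ssubset_iff_subset_ne.2
          ⟨fun w hw => Command.mem_run_of_keeps (c := round) peel_keeps hw, Ne.symm heq⟩)
  change removed n (runLoop (fun v => round.run 2 (Function.update ρ 1 v)) (ρ 0) σ) = _ ↔ _
  obtain ⟨hτ, hor⟩ := key
  rw [← hτ.2]
  constructor
  · intro h
    rw [h, Set.compl_univ]
    exact H.dec_empty
  · intro h
    rcases hor with hor | hor
    · by_contra hne
      obtain ⟨e, he⟩ := h.exists_mem_peelSet (Set.nonempty_compl.2 hne)
      exact hor e he
    · refine Set.eq_of_subset_of_ncard_le (Set.subset_univ _) ?_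
      rw [Set.ncard_univ, Nat.card_eq_fintype_card, Fintype.card_fin]
      exact h0.ge.trans hor

theorem mem_run_peelAll {H : ECGraph (Fin n)} (hH : H.IsReflexiveComplete) {σ : Store}
    (hσ : Encodes H σ) (hD : removed n σ = ∅) (hout : (6, n) ∉ σ) {ρ : ℕ → ℕ} (h0 : ρ 0 = n) :
    (6, n) ∈ peelAll.run 1 ρ σ ↔ ¬ H.Dec Set.univ := by
  rw [← removed_eq_univ_iff hH hσ hD h0]
  set τ := (Command.loop round).run 1 ρ σ
  have hτ : (6, n) ∉ τ := (Command.mem_run_of_avoids (c := .loop round)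
    (peel_avoids 6 (by simp) (by simp) (by simp) (by simp))).not.2 hout
  have key := runLoop_invariant
    (G := fun v => (Command.ite (.not (.mem 2 1)) (.put 6 0)).run 2 (Function.update ρ 1 v))
    (n := ρ 0) (fun v τ' => (∀ w, (2, w) ∈ τ' ↔ (2, w) ∈ τ) ∧
      ((6, n) ∈ τ' ↔ ∃ w < v, (2, w) ∉ τ)) (a := τ) ⟨fun _ => Iff.rfl, by simpa using hτ⟩ (by
    intro v _ τ' ⟨h₁, h₂⟩
    refine ⟨fun w => (Command.mem_run_of_avoids (c := .ite (.not (.mem 2 1)) (.put 6 0))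
      (show 6 ≠ 2 by simp)).trans (h₁ w), ?_⟩
    rw [Command.run, Cond.Holds, Cond.Holds, Function.update_self, h₁, Nat.exists_lt_succ_right]
    by_cases h : (2, v) ∈ τ
    · simp [h, h₂]
    · simp [h, Command.run, h0])
  rw [peelAll, Command.run]
  refine key.2.trans ?_
  rw [Set.eq_univ_iff_forall, h0]
  push Not
  exact ⟨fun ⟨w, hw, h⟩ => ⟨⟨w, hw⟩, h⟩, fun ⟨w, h⟩ => ⟨w, w.2, h⟩⟩

/-! ### The input and the final program. -/

/-- The store that contains the adjacency matrices of `H` and nothing else. -/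
def initialStore (H : ECGraph (Fin n)) : Store :=
  {p | ∃ i j : Fin n, p.2 = i * n + j ∧ ((p.1 = 0 ∧ H.red i j) ∨ (p.1 = 1 ∧ H.blue i j))}

theorem arr_input (H : ECGraph (Fin n)) : (input H).arr = (initialStore H).arr := by
  funext a k
  by_cases h : (a, k) ∈ initialStore H
  · exact (if_pos h).trans (if_pos h).symm
  · exact (if_neg h).trans (if_neg h).symm

theorem encodes_initialStore (H : ECGraph (Fin n)) : Encodes H (initialStore H) := by
  intro c i j
  constructor
  · rintro ⟨i', j', heq, h⟩
    -- Division by `n` recovers the row from a row-major index; `n` is positive because `Fin n` is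
    -- inhabited.
    have hdiv : ∀ a b : Fin n, ((a : ℕ) * n + b) / n = a := fun a b => by
      rw [mul_comm, Nat.mul_add_div (by have := b.2; omega), Nat.div_eq_of_lt b.2, add_zero]
    have hi : i = i' := by
      apply Fin.ext
      rw [← hdiv i j, ← hdiv i' j']
      exact congrArg (· / n) heq
    subst hi
    have hj : j = j' := Fin.ext (Nat.add_left_cancel heq)
    subst hj
    cases c <;> simpa [matrixArray, edge] using h
  · intro h
    refine ⟨i, j, rfl, ?_⟩
    cases c
    exacts [.inr ⟨rfl, h⟩, .inl ⟨rfl, h⟩]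

theorem peelAll_scoped : peelAll.Scoped 1 := by
  simp [peelAll, round, peel, mark, closure, pass, inferAll, infer, implied, conflict,
    Command.Scoped, Cond.Scoped, endRegister]

end Peeling

theorem mainTheorem12 :
    ∃ (P : RAM.Program) (p : Polynomial ℕ),
      ∀ (n : ℕ) (H : ECGraph (Fin n)), H.IsReflexiveComplete →
        ∃ (s : RAM.State) (t : ℕ),
          RAM.Exec P (RAM.input H) s t ∧ t ≤ p.eval n ∧
            (H.CoreAdmitsDecomposition → s.reg 0 = 1) ∧
            (¬ H.CoreAdmitsDecomposition → s.reg 0 = 0) := by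
  -- The flag reports a vertex that is left, so the answer is one minus the flag; this takes the
  -- three additional steps.
  refine ⟨.seq (Peeling.peelAll.compile 1) (.seq (.load 1 6 0) (.seq (.const 2 1) (.sub 0 2 1))),
    Peeling.peelAll.cost + 3, fun n H hH => ?_⟩
  have hn : (RAM.input H).reg 0 = n := rfl
  obtain ⟨s, t, hex, ht, hreg, harr⟩ := RAM.Command.exec_compile (k := 1) one_pos Peeling.peelAll
    Peeling.peelAll_scoped (RAM.input H) _ (Peeling.arr_input H) (by
      intro r hr
      rw [Nat.lt_one_iff.1 hr])
  rw [hn] at ht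
  have hs : s.reg 0 = n := (hreg 0 one_pos).trans hn
  have key := Peeling.mem_run_peelAll hH (Peeling.encodes_initialStore H)
    (by simp [Peeling.removed, Peeling.initialStore]) (by simp [Peeling.initialStore]) hn
  refine ⟨_, _, .seq hex (.seq (.load 1 6 0 s) (.seq (.const 2 1 _) (.sub 0 2 1 _))), ?_, ?_⟩
  · simp
    omega
  · rw [H.coreAdmitsDecomposition_iff]
    constructor <;> intro h <;> simp [RAM.State.setReg, harr, hs, RAM.Store.arr, key, h]
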